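/- **Setting.** There are $U\ge 1$ users, $K\ge 1$ arms and $T\ge\max\{U,K\}$ rounds. The learner knows $U,K,T$, the arm costs $c_k\ge 0$ and a budget $B\in\mathbb N$ with $c_k\le B$ for all $k$. A matching $\pi:[U]\to[K]$ is feasible if $\sum_{k\in\mathrm{Im}(\pi)}c_k\le B$; $\Pi$ is the set of feasible matchings. For each user-arm pair there is an unknown, otherwise arbitrary reward distribution $D_{u,k}$ supported on $[0,1]$, with mean $\theta_{u,k}$. In round $t$ a (possibly randomized) learner chooses $\pi_t\in\Pi$ on the basis of the past matchings and observed rewards; then, independently over users and of the past, rewards $r^t_{u}\sim D_{u,\pi_t(u)}$ are drawn and observed for all users $u$. With $V(\pi;\Theta)=\sum_u\theta_{u,\pi(u)}$, the regret is $$R_T=T\max_{\pi\in\Pi}V(\pi;\Theta)-\mathbb E\Big[\sum_{t=1}^T\sum_{u}r^t_{u}\Big].$$ **Algorithm (CUCB).** In each round, let $n_{u,k}$ be the number of past rounds in which $u$ was matched to $k$ and $\bar\theta_{u,k}$ the average of the rewards observed in them, and put $P_{u,k}=\bar\theta_{u,k}+\sqrt{2\ln T/n_{u,k}}$ if $n_{u,k}>0$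 and $P_{u,k}=\infty$ otherwise. Play some $\pi\in\Pi$ that maximizes $V(\pi;P)=\sum_u P_{u,\pi(u)}$ over $\Pi$, where matchings of infinite value are compared by their number of infinite terms; remaining ties may be broken arbitrarily. (No bound on the running time is claimed.) **Statement.** 1. There is a universal constant $C>0$ such that, for all $U,K,T$, costs and budget as above, the algorithm can be implemented, and every implementation of it satisfies, for all reward distributions $(D_{u,k})$, $$R_T\le C\,U\sqrt{KT\ln T}.$$ 2. This is optimal up to logarithmic factors: there is a universal constant $c>0$ such that for all $U\ge1$, $K\ge2$ and $T\ge\max\{U,K\}$ there are costs and a budget as above for which every learner, computationally efficient or not, has regret $R_T\ge c\,U\sqrt{KT}$ for some choice of the reward distributions $(D_{u,k})$. -/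

import Mathlib

open MeasureTheory ProbabilityTheory
open scoped ENNReal NNReal

/-- A matching assigns one of the `K` arms to each of the `U` users. -/
abbrev Matching (U K : ℕ) : Type := Fin U → Fin K

/-- What the learner sees in one round (semi-bandit feedback): the chosen matching and, for each
user, the reward of that user's assigned arm. -/
abbrev Round (U K : ℕ) : Type := Matching U K × (Fin U → ℝ)

/-- The history of the first `t` rounds. -/
abbrev History (U K t : ℕ) : Type := Fin t → Round U K

/-- The known budget constraint of an instance: arm costs and a budget, where every single arm is
affordable. -/
structure BudgetConstraint (K : ℕ) where
  cost : Fin K → ℝ≥0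
  budget : ℕ
  cost_le : ∀ k, cost k ≤ budget

/-- A matching is feasible if the total cost of the arms in its image is within the budget. -/
def BudgetConstraint.Feasible {U K : ℕ} (b : BudgetConstraint K) (π : Matching U K) : Prop :=
  ∑ k ∈ Finset.univ.image π, b.cost k ≤ b.budget

/-- The unknown reward distributions `D u k`, supported on `[0, 1]`. -/
structure RewardModel (U K : ℕ) where
  D : Fin U → Fin K → Measure ℝ
  isProb : ∀ u k, IsProbabilityMeasure (D u k)
  support : ∀ u k, ∀ᵐ x ∂(D u k), x ∈ Set.Icc (0 : ℝ) 1

attribute [instance] RewardModel.isProb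

/-- The expected reward `θ u k`. -/
noncomputable def RewardModel.mean {U K : ℕ} (D : RewardModel U K) (u : Fin U) (k : Fin K) : ℝ :=
  ∫ x, x ∂(D.D u k)

/-- Total expected reward `V(π; Θ)` of a matching. -/
noncomputable def RewardModel.value {U K : ℕ} (D : RewardModel U K) (π : Matching U K) : ℝ :=
  ∑ u, D.mean u (π u)

/-- The value of the best feasible matching. -/
noncomputable def RewardModel.optValue {U K : ℕ} (D : RewardModel U K)
    (b : BudgetConstraint K) : ℝ :=
  ⨆ π : {π : Matching U K // b.Feasible π}, D.value π.1

/-- Given the matching `π`, the observed rewards are independent over the users, the reward of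
user `u` having law `D u (π u)`. -/
noncomputable def RewardModel.rewardKernel {U K : ℕ} (D : RewardModel U K) :
    Kernel (Matching U K) (Fin U → ℝ) where
  toFun π := Measure.pi fun u => D.D u (π u)
  measurable' := measurable_of_countable _

instance {U K : ℕ} (D : RewardModel U K) : IsMarkovKernel D.rewardKernel :=
  ⟨fun π => by
    change IsProbabilityMeasure (Measure.pi fun u => D.D u (π u))
    infer_instance⟩

/-- A (possibly randomized) learner: after each history, a law on feasible matchings.
It does not see the reward distributions. -/
structure Learner (U : ℕ) {K : ℕ} (b : BudgetConstraint K) where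
  policy : (t : ℕ) → Kernel (History U K t) (Matching U K)
  isMarkov : ∀ t, IsMarkovKernel (policy t)
  feasible : ∀ t h, ∀ᵐ π ∂(policy t h), b.Feasible π

attribute [instance] Learner.isMarkov

/-- One round of interaction: the learner draws a matching from its policy given the history, and
then the rewards are drawn given that matching, independently of the past. -/
noncomputable def roundKernel {U K : ℕ} {b : BudgetConstraint K} (A : Learner U b)
    (D : RewardModel U K) (t : ℕ) : Kernel (History U K t) (Round U K) :=
  A.policy t ⊗ₖ Kernel.prodMkLeft (History U K t) D.rewardKernel

instance {U K : ℕ} {b : BudgetConstraint K} (A : Learner U b) (D : RewardModel U K) (t : ℕ) :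
    IsMarkovKernel (roundKernel A D t) := by
  unfold roundKernel; infer_instance

/-- Append a round to a history. -/
def appendRound {U K t : ℕ} (p : History U K t × Round U K) : History U K (t + 1) :=
  Fin.snoc (α := fun _ => Round U K) p.1 p.2

/-- The law of the first `t` rounds when the learner `A` interacts with the rewards `D`. -/
noncomputable def historyLaw {U K : ℕ} {b : BudgetConstraint K} (A : Learner U b)
    (D : RewardModel U K) : (t : ℕ) → Measure (History U K t)
  | 0 => Measure.dirac Fin.elim0
  | t + 1 => ((historyLaw A D t) ⊗ₘ (roundKernel A D t)).map appendRound

theorem measurable_appendRound {U K t : ℕ} :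
    Measurable (appendRound : History U K t × Round U K → History U K (t + 1)) := by
  refine measurable_pi_lambda _ fun i => ?_
  induction i using Fin.lastCases with
  | last => simpa [appendRound] using measurable_snd
  | cast i =>
    simp only [appendRound, Fin.snoc_castSucc]
    exact (measurable_pi_apply i).comp measurable_fst

instance isProbabilityMeasure_historyLaw {U K : ℕ} {b : BudgetConstraint K} (A : Learner U b)
    (D : RewardModel U K) (t : ℕ) : IsProbabilityMeasure (historyLaw A D t) := by
  induction t with
  | zero => unfold historyLaw; infer_instance
  | succ t ih =>
    unfold historyLaw
    exact Measure.isProbabilityMeasure_map measurable_appendRound.aemeasurable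

/-- The expected regret over `T` rounds. -/
noncomputable def regret {U K : ℕ} {b : BudgetConstraint K} (T : ℕ) (A : Learner U b)
    (D : RewardModel U K) : ℝ :=
  T * D.optValue b - ∫ h, ∑ t, ∑ u, (h t).2 u ∂(historyLaw A D T)

/-- The number of past rounds in which user `u` was assigned arm `k`. -/
def pullCount {U K t : ℕ} (h : History U K t) (u : Fin U) (k : Fin K) : ℕ :=
  (Finset.univ.filter fun s => (h s).1 u = k).card

/-- The average of the rewards observed for the pair `(u, k)`. -/
noncomputable def empMean {U K t : ℕ} (h : History U K t) (u : Fin U) (k : Fin K) : ℝ :=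
  (∑ s ∈ Finset.univ.filter (fun s => (h s).1 u = k), (h s).2 u) / pullCount h u k

/-- The upper confidence index of the pair `(u, k)` for horizon `T`; it is `∞` for a pair that has
not been tried yet. -/
noncomputable def ucb {U K t : ℕ} (T : ℕ) (h : History U K t) (u : Fin U) (k : Fin K) : EReal :=
  if 0 < pullCount h u k then
    ((empMean h u k + Real.sqrt (2 * Real.log T / pullCount h u k) : ℝ) : EReal)
  else ⊤

/-- The optimistic value `V(π; P)` of a matching, `P` being the matrix of upper confidence
indices. -/
noncomputable def ucbValue {U K t : ℕ} (T : ℕ) (h : History U K t) (π : Matching U K) : EReal :=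
  ∑ u, ucb T h u (π u)

/-- The number of users that the matching assigns to an arm not yet tried for them, that is, the
number of infinite terms in `V(π; P)`. -/
def untriedCount {U K t : ℕ} (h : History U K t) (π : Matching U K) : ℕ :=
  (Finset.univ.filter fun u => pullCount h u (π u) = 0).card

/-- `π` maximizes `V(π; P)` over the feasible matchings, where matchings of infinite value are
compared by their number of infinite terms. All other ties are left open. -/
def IsOptimisticChoice {U K t : ℕ} (b : BudgetConstraint K) (T : ℕ) (h : History U K t)
    (π : Matching U K) : Prop :=
  b.Feasible π ∧
    (∀ π' : Matching U K, b.Feasible π' → ucbValue T h π' ≤ ucbValue T h π) ∧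
    (∀ π' : Matching U K, b.Feasible π' → untriedCount h π' ≤ untriedCount h π)

/-- `A` runs the combinatorial UCB algorithm with horizon `T`: in each of the `T` rounds it plays
an optimal matching for the current upper confidence indices. -/
def IsCUCB {U K : ℕ} {b : BudgetConstraint K} (T : ℕ) (A : Learner U b) : Prop :=
  ∀ t < T, ∀ h : History U K t, ∀ᵐ π ∂(A.policy t h), IsOptimisticChoice b T h π

/-!
Lower bound. All matchings are affordable and all rewards are Bernoulli with parameter `1 / 2`,
except that every user `u` has one better arm `κ u`, with gap `ε` of order `√(K / T)`. By the
divergence decomposition, the laws of the history with and without the planted arm of `u` have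
relative entropy `O(ε²)` times the expected number of pulls of that arm without it. These numbers
add up to `T` over the `K` possible arms, so planting an arm raises the expected number of its
pulls only to a fraction of `T`, on average over the arms. Averaging over `κ` therefore gives a
matching `κ` whose arms are missed in a fixed fraction of the `U T` plays, each at the cost `ε`.

Upper bound. The product over the rounds of the exponential likelihood ratios from Hoeffding's lemma
has expectation at most one, whatever the learner does, so all confidence intervals hold in a
given round up to probability `O(1 / T)`. While pairs are untried, the best of the `K` constant
matchings tries at least a fraction `1 / K` of them, and so does the optimistic one, so after
`2 K log T` rounds every pair has been tried. From then on the loss of an optimistic matching is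
at most twice the sum of its confidence widths, which is paid for by the increase of the potential
`∑ √(pullCount h u k) ≤ U √(K T)`.
-/

/-! ### The law of the history -/

section HistoryLaw

variable {U K t : ℕ} {b : BudgetConstraint K} (A : Learner U b) (D : RewardModel U K)

theorem sum_appendRound {M : Type*} [AddCommMonoid M] (f : Round U K → M)
    (x : History U K t × Round U K) :
    ∑ s, f (appendRound x s) = ∑ s, f (x.1 s) + f x.2 := by
  simp [appendRound, Fin.sum_univ_castSucc]

theorem prod_appendRound {M : Type*} [CommMonoid M] (f : Round U K → M)
    (x : History U K t × Round U K) :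
    ∏ s, f (appendRound x s) = (∏ s, f (x.1 s)) * f x.2 := by
  simp [appendRound, Fin.prod_univ_castSucc]

/-- The joint law of the history of the first `t` rounds and the round that follows it; `historyLaw`
glues the two together. -/
noncomputable def stepLaw (t : ℕ) : Measure (History U K t × Round U K) :=
  historyLaw A D t ⊗ₘ roundKernel A D t

instance isProbabilityMeasure_stepLaw : IsProbabilityMeasure (stepLaw A D t) := by
  unfold stepLaw; infer_instance

theorem historyLaw_succ : historyLaw A D (t + 1) = (stepLaw A D t).map appendRound := rfl

theorem map_fst_stepLaw : (stepLaw A D t).map Prod.fst = historyLaw A D t :=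
  Measure.fst_compProd _ _

theorem lintegral_roundKernel (h : History U K t) {F : Round U K → ℝ≥0∞} (hF : Measurable F) :
    ∫⁻ x, F x ∂(roundKernel A D t h) =
      ∫⁻ π, ∫⁻ r, F (π, r) ∂(D.rewardKernel π) ∂(A.policy t h) :=
  Kernel.lintegral_compProd _ _ _ hF

theorem lintegral_historyLaw_succ {F : History U K (t + 1) → ℝ≥0∞} (hF : Measurable F) :
    ∫⁻ h, F h ∂(historyLaw A D (t + 1)) =
      ∫⁻ h, ∫⁻ x, F (appendRound (h, x)) ∂(roundKernel A D t h) ∂(historyLaw A D t) := by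
  rw [historyLaw_succ, lintegral_map hF measurable_appendRound]
  exact Measure.lintegral_compProd (hF.comp measurable_appendRound)

theorem ae_stepLaw_of_ae_policy {p : History U K t → Matching U K → Prop}
    (hp : MeasurableSet {x : History U K t × Matching U K | p x.1 x.2})
    (h : ∀ h, ∀ᵐ π ∂(A.policy t h), p h π) : ∀ᵐ x ∂(stepLaw A D t), p x.1 x.2.1 := by
  refine Measure.ae_compProd_of_ae_ae
    (hp.preimage (measurable_fst.prodMk (measurable_fst.comp measurable_snd)))
    (ae_of_all _ fun h' => ?_)
  refine Kernel.ae_compProd_of_ae_ae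
    (hp.preimage (measurable_prodMk_left.comp measurable_fst)) ?_
  exact (h h').mono fun π hπ => ae_of_all _ fun _ => hπ

theorem map_snd_stepLaw : (stepLaw A D t).map Prod.snd =
    ((stepLaw A D t).map fun x => x.2.1) ⊗ₘ D.rewardKernel := by
  have hm : Measurable fun x : History U K t × Round U K => x.2.1 := by fun_prop
  refine Measure.ext_of_lintegral _ fun f hf => ?_
  have hf' : Measurable fun π : Matching U K => ∫⁻ r, f (π, r) ∂(D.rewardKernel π) :=
    measurable_of_countable _
  rw [lintegral_map hf measurable_snd, Measure.lintegral_compProd hf, lintegral_map hf' hm,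
    stepLaw, Measure.lintegral_compProd (f := fun x => f x.2) (hf.comp measurable_snd),
    Measure.lintegral_compProd
      (f := fun x : History U K t × Round U K => ∫⁻ r, f (x.2.1, r) ∂(D.rewardKernel x.2.1))
      (hf'.comp hm)]
  refine lintegral_congr fun h => ?_
  rw [lintegral_roundKernel A D h hf,
    lintegral_roundKernel A D h (F := fun x => ∫⁻ r, f (x.1, r) ∂(D.rewardKernel x.1))
      (hf'.comp measurable_fst)]
  simp

theorem map_round_historyLaw (s : Fin t) : (historyLaw A D t).map (fun h => h s) =
    ((historyLaw A D t).map fun h => (h s).1) ⊗ₘ D.rewardKernel := by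
  induction t with
  | zero => exact s.elim0
  | succ t ih =>
    have hs : ∀ n, ∀ s : Fin n, Measurable fun h : History U K n => (h s).1 :=
      fun n s => measurable_fst.comp (measurable_pi_apply s)
    rw [historyLaw_succ, Measure.map_map (measurable_pi_apply s) measurable_appendRound,
      Measure.map_map (hs _ s) measurable_appendRound]
    induction s using Fin.lastCases with
    | last => simpa [Function.comp_def, appendRound] using map_snd_stepLaw A D
    | cast s =>
      have ih := ih s
      rw [← map_fst_stepLaw, Measure.map_map (measurable_pi_apply s) measurable_fst,
        Measure.map_map (hs _ s) measurable_fst] at ih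
      simpa [Function.comp_def, appendRound] using ih

theorem ae_round_historyLaw {p : Round U K → Prop} (hp : MeasurableSet {x | p x})
    (h : ∀ π, ∀ᵐ r ∂(D.rewardKernel π), p (π, r)) (s : Fin t) :
    ∀ᵐ h ∂(historyLaw A D t), p (h s) := by
  refine ae_of_ae_map (μ := historyLaw A D t) (f := fun h => h s)
    (measurable_pi_apply s).aemeasurable ?_
  rw [map_round_historyLaw]
  exact Measure.ae_compProd_of_ae_ae hp (ae_of_all _ h)

theorem measurable_comp_matchings {β : Type*} [MeasurableSpace β]
    (f : (Fin t → Matching U K) → β) :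
    Measurable fun h : History U K t => f fun s => (h s).1 :=
  (measurable_of_countable f).comp
    (measurable_pi_lambda _ fun s => measurable_fst.comp (measurable_pi_apply s))

theorem integrable_comp_matchings (f : (Fin t → Matching U K) → ℝ) :
    Integrable (fun h => f fun s => (h s).1) (historyLaw A D t) := by
  have hm := measurable_comp_matchings (U := U) (K := K) (t := t) id
  have := Measure.isProbabilityMeasure_map (μ := historyLaw A D t) hm.aemeasurable
  exact (Integrable.of_finite (f := f) (μ := (historyLaw A D t).map _)).comp_measurable hm

theorem integrable_round {φ : Round U K → ℝ} (hφ : Measurable φ)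
    (hi : ∀ π, Integrable (fun r => φ (π, r)) (D.rewardKernel π)) (s : Fin t) :
    Integrable (fun h => φ (h s)) (historyLaw A D t) := by
  have hs : Measurable fun h : History U K t => (h s).1 :=
    measurable_fst.comp (measurable_pi_apply s)
  have := Measure.isProbabilityMeasure_map (μ := historyLaw A D t) hs.aemeasurable
  refine Integrable.comp_measurable (g := φ) (f := fun h : History U K t => h s) ?_
    (measurable_pi_apply s)
  rw [map_round_historyLaw, Measure.integrable_compProd_iff hφ.aestronglyMeasurable]
  exact ⟨ae_of_all _ hi, Integrable.of_finite⟩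

theorem integral_sum_round {φ : Round U K → ℝ} (hφ : Measurable φ)
    (hi : ∀ π, Integrable (fun r => φ (π, r)) (D.rewardKernel π)) :
    ∫ h, ∑ s, φ (h s) ∂(historyLaw A D t) =
      ∫ h, ∑ s, ∫ r, φ ((h s).1, r) ∂(D.rewardKernel (h s).1) ∂(historyLaw A D t) := by
  have hround := integrable_round A D (t := t) hφ hi
  rw [integral_finsetSum _ fun s _ => hround s, integral_finsetSum _ fun s _ =>
    integrable_comp_matchings A D fun m => ∫ r, φ (m s, r) ∂(D.rewardKernel (m s))]
  refine Finset.sum_congr rfl fun s _ => ?_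
  have hs : Measurable fun h : History U K t => (h s).1 :=
    measurable_fst.comp (measurable_pi_apply s)
  have hmap : Integrable φ ((historyLaw A D t).map fun h => h s) :=
    (integrable_map_measure hφ.aestronglyMeasurable
      (measurable_pi_apply s).aemeasurable).2 (hround s)
  rw [← integral_map (φ := fun h : History U K t => h s) (measurable_pi_apply s).aemeasurable
    hφ.aestronglyMeasurable]
  rw [map_round_historyLaw] at hmap ⊢
  have := Measure.isProbabilityMeasure_map (μ := historyLaw A D t) hs.aemeasurable
  rw [Measure.integral_compProd hmap,
    integral_map hs.aemeasurable (measurable_of_countable _).aestronglyMeasurable]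

end HistoryLaw

/-! ### Mean rewards and the regret -/

section Rewards

variable {U K : ℕ}

namespace RewardModel

variable (D : RewardModel U K)

theorem integrable_id (u : Fin U) (k : Fin K) : Integrable (fun x => x) (D.D u k) :=
  Integrable.of_mem_Icc 0 1 aemeasurable_id (D.support u k)

theorem mean_mem_Icc (u : Fin U) (k : Fin K) : D.mean u k ∈ Set.Icc (0 : ℝ) 1 :=
  (convex_Icc 0 1).integral_mem isClosed_Icc (D.support u k) (D.integrable_id u k)

theorem value_nonneg (π : Matching U K) : 0 ≤ D.value π :=
  Finset.sum_nonneg fun u _ => (D.mean_mem_Icc u _).1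

theorem value_le (π : Matching U K) : D.value π ≤ U :=
  (Finset.sum_le_sum fun u _ => (D.mean_mem_Icc u _).2).trans (by simp)

theorem value_le_optValue {b : BudgetConstraint K} {π : Matching U K} (hπ : b.Feasible π) :
    D.value π ≤ D.optValue b :=
  le_ciSup (f := fun π : {π : Matching U K // b.Feasible π} => D.value π.1)
    (Set.toFinite _).bddAbove ⟨π, hπ⟩

theorem optValue_le (b : BudgetConstraint K) : D.optValue b ≤ U :=
  Real.iSup_le (fun π => D.value_le π.1) (Nat.cast_nonneg U)

theorem map_eval_rewardKernel (π : Matching U K) (u : Fin U) :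
    (D.rewardKernel π).map (fun r => r u) = D.D u (π u) :=
  (measurePreserving_eval (fun u => D.D u (π u)) u).map_eq

theorem integrable_apply_rewardKernel (π : Matching U K) (u : Fin U) :
    Integrable (fun r => r u) (D.rewardKernel π) :=
  Integrable.comp_measurable (g := fun x : ℝ => x) (f := fun r : Fin U → ℝ => r u)
    (by rw [D.map_eval_rewardKernel]; exact D.integrable_id u _) (measurable_pi_apply u)

theorem integral_sum_rewardKernel (π : Matching U K) :
    ∫ r, ∑ u, r u ∂(D.rewardKernel π) = D.value π := by
  rw [integral_finsetSum _ fun u _ => D.integrable_apply_rewardKernel π u]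
  refine Finset.sum_congr rfl fun u _ => ?_
  rw [mean, ← D.map_eval_rewardKernel π u]
  exact (integral_map (φ := fun r : Fin U → ℝ => r u) (measurable_pi_apply u).aemeasurable
    aestronglyMeasurable_id).symm

end RewardModel

variable {b : BudgetConstraint K} (A : Learner U b) (D : RewardModel U K)

theorem regret_eq_integral_sum (T : ℕ) :
    regret T A D = ∫ h, ∑ t, (D.optValue b - D.value (h t).1) ∂(historyLaw A D T) := by
  have hrewards : ∫ h, ∑ t, ∑ u, (h t).2 u ∂(historyLaw A D T) =
      ∫ h, ∑ t, D.value (h t).1 ∂(historyLaw A D T) := by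
    have := integral_sum_round A D (t := T) (φ := fun x => ∑ u, x.2 u) (by fun_prop)
      fun π => integrable_finsetSum _ fun u _ => D.integrable_apply_rewardKernel π u
    simpa only [D.integral_sum_rewardKernel] using this
  simp_rw [regret, hrewards, Finset.sum_sub_distrib]
  rw [integral_sub (integrable_const _)
    (integrable_comp_matchings A D fun m => ∑ t, D.value (m t))]
  simp

theorem regret_le_mul_users (T : ℕ) : regret T A D ≤ T * U := by
  rw [regret_eq_integral_sum]
  refine (integral_mono (integrable_comp_matchings A D fun m =>
    ∑ t, (D.optValue b - D.value (m t))) (integrable_const ((T : ℝ) * U)) fun h => ?_).trans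
      (by simp)
  calc ∑ t, (D.optValue b - D.value (h t).1) ≤ ∑ _t : Fin T, (U : ℝ) :=
        Finset.sum_le_sum fun t _ => by
          linarith [D.optValue_le b, D.value_nonneg (h t).1]
    _ = T * U := by simp

end Rewards

/-! ### Pull counts -/

section PullCount

variable {U K t : ℕ}

theorem pullCount_eq_sum (h : History U K t) (u : Fin U) (k : Fin K) :
    pullCount h u k = ∑ s, if (h s).1 u = k then 1 else 0 := by
  simp [pullCount, Finset.sum_boole]

theorem pullCount_appendRound (x : History U K t × Round U K) (u : Fin U) (k : Fin K) :
    pullCount (appendRound x) u k = pullCount x.1 u k + if x.2.1 u = k then 1 else 0 := by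
  simp only [pullCount_eq_sum]
  exact sum_appendRound (fun y : Round U K => if y.1 u = k then 1 else 0) x

theorem sum_pullCount (h : History U K t) (u : Fin U) : ∑ k, pullCount h u k = t := by
  simp only [pullCount_eq_sum]
  rw [Finset.sum_comm]
  simp

theorem pullCount_le (h : History U K t) (u : Fin U) (k : Fin K) : pullCount h u k ≤ t :=
  (Finset.card_filter_le _ _).trans (by simp)

theorem measurable_pullCount (u : Fin U) (k : Fin K) :
    Measurable fun h : History U K t => pullCount h u k :=
  measurable_comp_matchings fun m : Fin t → Matching U K =>
    (Finset.univ.filter fun s => m s u = k).card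

theorem measurable_natCast_pullCount (u : Fin U) (k : Fin K) :
    Measurable fun h : History U K t => (pullCount h u k : ℝ) :=
  measurable_from_nat.comp (measurable_pullCount u k)

theorem integrable_pullCount {b : BudgetConstraint K} (A : Learner U b) (D : RewardModel U K)
    (u : Fin U) (k : Fin K) :
    Integrable (fun h : History U K t => (pullCount h u k : ℝ)) (historyLaw A D t) :=
  integrable_comp_matchings A D fun m => ((Finset.univ.filter fun s => m s u = k).card : ℝ)

end PullCount

/-! ### Likelihood ratios -/

section Likelihood

variable {U K : ℕ} {b : BudgetConstraint K} (A : Learner U b) {D D' : RewardModel U K}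
  {ℓ : Round U K → ℝ≥0∞}

theorem measurable_prod_rounds (hℓ : Measurable ℓ) (t : ℕ) :
    Measurable fun h : History U K t => ∏ s, ℓ (h s) :=
  Finset.measurable_prod _ fun s _ => hℓ.comp (measurable_pi_apply s)

theorem lintegral_prod_rounds_le_one (hℓ : Measurable ℓ)
    (h : ∀ π, ∫⁻ r, ℓ (π, r) ∂(D.rewardKernel π) ≤ 1) (t : ℕ) :
    ∫⁻ h, ∏ s, ℓ (h s) ∂(historyLaw A D t) ≤ 1 := by
  induction t with
  | zero => simp [historyLaw]
  | succ t ih =>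
    rw [lintegral_historyLaw_succ A D (measurable_prod_rounds hℓ _)]
    refine le_trans (lintegral_mono fun h' => ?_) ih
    calc ∫⁻ x, ∏ s, ℓ (appendRound (h', x) s) ∂(roundKernel A D t h')
        = (∏ s, ℓ (h' s)) * ∫⁻ π, ∫⁻ r, ℓ (π, r) ∂(D.rewardKernel π) ∂(A.policy t h') := by
          simp_rw [prod_appendRound]
          rw [lintegral_const_mul _ hℓ, lintegral_roundKernel A D h' hℓ]
      _ ≤ (∏ s, ℓ (h' s)) * ∫⁻ _, 1 ∂(A.policy t h') := by
          gcongr with π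
          exact h π
      _ = ∏ s, ℓ (h' s) := by simp

theorem roundKernel_eq_withDensity (hℓ : Measurable ℓ)
    (h : ∀ π, D'.rewardKernel π = (D.rewardKernel π).withDensity fun r => ℓ (π, r)) {t : ℕ}
    (h' : History U K t) : roundKernel A D' t h' = (roundKernel A D t h').withDensity ℓ := by
  refine Measure.ext_of_lintegral _ fun f hf => ?_
  rw [lintegral_withDensity_eq_lintegral_mul _ hℓ hf, lintegral_roundKernel A D' h' hf,
    lintegral_roundKernel A D h' (hℓ.mul hf)]
  refine lintegral_congr fun π => ?_
  rw [h]
  exact lintegral_withDensity_eq_lintegral_mul _ (hℓ.comp measurable_prodMk_left)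
    (hf.comp measurable_prodMk_left)

theorem historyLaw_eq_withDensity (hℓ : Measurable ℓ)
    (h : ∀ π, D'.rewardKernel π = (D.rewardKernel π).withDensity fun r => ℓ (π, r)) (t : ℕ) :
    historyLaw A D' t = (historyLaw A D t).withDensity fun h => ∏ s, ℓ (h s) := by
  induction t with
  | zero => simp [historyLaw]
  | succ t ih =>
    refine Measure.ext_of_lintegral _ fun f hf => ?_
    have hfa : Measurable fun x : History U K t × Round U K => f (appendRound x) :=
      hf.comp measurable_appendRound
    have hℓf : Measurable fun x : History U K t × Round U K => ℓ x.2 * f (appendRound x) :=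
      (hℓ.comp measurable_snd).mul hfa
    have hround (h' : History U K t) : ∫⁻ x, f (appendRound (h', x)) ∂(roundKernel A D' t h') =
        ∫⁻ x, ℓ x * f (appendRound (h', x)) ∂(roundKernel A D t h') := by
      rw [roundKernel_eq_withDensity A hℓ h]
      exact lintegral_withDensity_eq_lintegral_mul _ hℓ (hfa.comp measurable_prodMk_left)
    rw [lintegral_withDensity_eq_lintegral_mul _ (measurable_prod_rounds hℓ _) hf,
      lintegral_historyLaw_succ A D ((measurable_prod_rounds hℓ _).mul hf),
      lintegral_historyLaw_succ A D' hf]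
    simp_rw [hround]
    rw [ih, lintegral_withDensity_eq_lintegral_mul _ (measurable_prod_rounds hℓ t)
      hℓf.lintegral_kernel_prod_right']
    refine lintegral_congr fun h' => ?_
    simp only [Pi.mul_apply]
    simp_rw [prod_appendRound, mul_assoc]
    exact (lintegral_const_mul _ (hℓf.comp measurable_prodMk_left)).symm

theorem pi_withDensity_of_eq_off {ι : Type*} [Fintype ι] {X : ι → Type*}
    [∀ i, MeasurableSpace (X i)] (μ ν : (i : ι) → Measure (X i)) [∀ i, IsProbabilityMeasure (μ i)]
    [∀ i, SigmaFinite (ν i)] (u : ι) {g : X u → ℝ≥0∞} (hg : Measurable g)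
    (hu : ν u = (μ u).withDensity g) (hne : ∀ i, i ≠ u → ν i = μ i) :
    Measure.pi ν = (Measure.pi μ).withDensity fun r => g (r u) := by
  classical
  refine Measure.pi_eq fun s hs => ?_
  have hmap : ((Measure.pi μ).restrict (Set.univ.pi s)).map (fun r => r u) =
      (∏ i ∈ Finset.univ.erase u, μ i (s i)) • (μ u).restrict (s u) := by
    rw [Measure.restrict_pi_pi]
    simpa using Measure.pi_map_eval (μ := fun i => (μ i).restrict (s i)) u
  rw [withDensity_apply _ (MeasurableSet.univ_pi hs),
    ← lintegral_map (f := g) hg (measurable_pi_apply u), hmap, lintegral_smul_measure,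
    ← withDensity_apply _ (hs u), ← hu, ← Finset.prod_erase_mul _ _ (Finset.mem_univ u),
    smul_eq_mul]
  congr 1
  exact Finset.prod_congr rfl fun i hi => by rw [hne i (Finset.ne_of_mem_erase hi)]

/-- The likelihood ratio of one round when only the reward law of the pair `(u, k)` changes, with
density `g`: the round is informative only if `u` is matched to `k`. -/
def roundLikelihood (u : Fin U) (k : Fin K) (g : ℝ → ℝ≥0∞) (x : Round U K) : ℝ≥0∞ :=
  if x.1 u = k then g (x.2 u) else 1

theorem measurable_roundLikelihood (u : Fin U) (k : Fin K) {g : ℝ → ℝ≥0∞} (hg : Measurable g) :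
    Measurable (roundLikelihood u k g) :=
  Measurable.ite (measurable_fst (Set.to_countable {π : Matching U K | π u = k}).measurableSet)
    (hg.comp ((measurable_pi_apply u).comp measurable_snd)) measurable_const

theorem lintegral_roundLikelihood_le_one {u : Fin U} {k : Fin K} {g : ℝ → ℝ≥0∞}
    (hg : Measurable g) (h : ∫⁻ x, g x ∂(D.D u k) ≤ 1) (π : Matching U K) :
    ∫⁻ r, roundLikelihood u k g (π, r) ∂(D.rewardKernel π) ≤ 1 := by
  by_cases hπ : π u = k
  · simp only [roundLikelihood, hπ, if_true]
    rwa [← lintegral_map hg (measurable_pi_apply u), D.map_eval_rewardKernel, hπ]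
  · simp [roundLikelihood, hπ]

theorem rewardKernel_eq_withDensity_roundLikelihood {u : Fin U} {k : Fin K} {g : ℝ → ℝ≥0∞}
    (hg : Measurable g) (hu : D'.D u k = (D.D u k).withDensity g)
    (hne : ∀ v j, (v, j) ≠ (u, k) → D'.D v j = D.D v j) (π : Matching U K) :
    D'.rewardKernel π = (D.rewardKernel π).withDensity fun r => roundLikelihood u k g (π, r) := by
  by_cases hπ : π u = k
  · simp only [roundLikelihood, hπ, if_true]
    exact pi_withDensity_of_eq_off (fun v => D.D v (π v)) (fun v => D'.D v (π v)) u hg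
      (by rw [hπ, hu]) fun v hv => hne v _ fun h => hv (congrArg Prod.fst h)
  · have hoff : ∀ v, D'.D v (π v) = D.D v (π v) := fun v =>
      hne v _ fun h => hπ (by rw [Prod.mk.injEq] at h; rw [← h.1, h.2])
    simp only [roundLikelihood, hπ, if_false]
    rw [← Pi.one_def, withDensity_one]
    exact congrArg Measure.pi (funext hoff)

end Likelihood

/-! ### Relative entropy -/

section RelativeEntropy

open InformationTheory

theorem sq_sqrt_sub_one_le_klFun {x : ℝ} (hx : 0 ≤ x) : (√x - 1) ^ 2 ≤ klFun x := by
  rcases hx.eq_or_lt with rfl | hpos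
  · simp [klFun]
  have hsqrt := Real.sqrt_pos.2 hpos
  have hlog : 1 - (√x)⁻¹ ≤ Real.log x / 2 := by
    rw [← Real.log_sqrt hx]
    exact Real.one_sub_inv_le_log_of_pos hsqrt
  have hmul : x * (1 - (√x)⁻¹) = √x ^ 2 - √x := by
    rw [← Real.sq_sqrt hx, Real.sqrt_sq hsqrt.le]
    field_simp
  have := mul_le_mul_of_nonneg_left hlog hx
  rw [klFun_apply]
  linarith [Real.sq_sqrt hx]

theorem one_sub_le_mul_klFun_add {x c : ℝ} (hx : 0 ≤ x) (hc : 0 < c) :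
    1 - x ≤ c * klFun x + (x + 1) / (2 * c) := by
  have hkl := mul_le_mul_of_nonneg_left (sq_sqrt_sub_one_le_klFun hx) hc.le
  have hamgm : 1 - x ≤ c * (√x - 1) ^ 2 + (√x + 1) ^ 2 / (4 * c) := by
    have : c * (√x - 1) ^ 2 + (√x + 1) ^ 2 / (4 * c) - (1 - √x ^ 2) =
        (2 * c * (√x - 1) + (√x + 1)) ^ 2 / (4 * c) := by
      field_simp
      ring
    rw [Real.sq_sqrt hx] at this
    linarith [show 0 ≤ (2 * c * (√x - 1) + (√x + 1)) ^ 2 / (4 * c) by positivity]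
  have hsq : (√x + 1) ^ 2 / (4 * c) ≤ (x + 1) / (2 * c) := by
    rw [div_le_div_iff₀ (by positivity) (by positivity)]
    nlinarith [Real.sq_sqrt hx, mul_nonneg hc.le (sq_nonneg (√x - 1))]
  linarith

/- A linearised form of Pinsker's inequality: the optimal `c` would give the square root of the
divergence. -/
theorem integral_le_integral_add_klDiv {Ω : Type*} [MeasurableSpace Ω] {μ ν : Measure Ω}
    [IsProbabilityMeasure μ] [IsProbabilityMeasure ν] (h : klDiv μ ν ≠ ∞) {f : Ω → ℝ}
    (hf : Measurable f) {M c : ℝ} (hM : ∀ x, f x ∈ Set.Icc 0 M) (hc : 0 < c) :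
    ∫ x, f x ∂ν ≤ ∫ x, f x ∂μ + M * (c * (klDiv μ ν).toReal + 1 / c) := by
  obtain ⟨hac, hllr⟩ := klDiv_ne_top_iff.1 h
  have hfi (ρ : Measure Ω) [IsFiniteMeasure ρ] : Integrable f ρ :=
    Integrable.of_mem_Icc 0 M hf.aemeasurable (ae_of_all _ hM)
  have hl : Integrable (fun x => (μ.rnDeriv ν x).toReal) ν := Measure.integrable_toReal_rnDeriv
  have hkl := (integrable_klFun_rnDeriv_iff hac).2 hllr
  have hl1 : ∫ x, (μ.rnDeriv ν x).toReal ∂ν = 1 := by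
    rw [Measure.integral_toReal_rnDeriv hac]
    simp
  have hpt (x : Ω) : f x ≤ (μ.rnDeriv ν x).toReal • f x + M *
      (c * klFun (μ.rnDeriv ν x).toReal + ((μ.rnDeriv ν x).toReal + 1) / (2 * c)) := by
    obtain ⟨h0, h1⟩ := hM x
    have hx := ENNReal.toReal_nonneg (a := μ.rnDeriv ν x)
    have hw : 0 ≤ c * klFun (μ.rnDeriv ν x).toReal + ((μ.rnDeriv ν x).toReal + 1) / (2 * c) :=
      add_nonneg (mul_nonneg hc.le (klFun_nonneg hx)) (by positivity)
    have := (mul_le_mul_of_nonneg_left (one_sub_le_mul_klFun_add hx hc) h0).trans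
      (mul_le_mul_of_nonneg_right h1 hw)
    rw [smul_eq_mul]
    linarith
  have hl' : Integrable (fun x => ((μ.rnDeriv ν x).toReal + 1) / (2 * c)) ν :=
    (hl.add (integrable_const 1)).div_const _
  have herr : Integrable (fun x => M *
      (c * klFun (μ.rnDeriv ν x).toReal + ((μ.rnDeriv ν x).toReal + 1) / (2 * c))) ν :=
    ((hkl.const_mul c).add hl').const_mul M
  have hlf := (integrable_rnDeriv_smul_iff hac).2 (hfi μ)
  refine (integral_mono (hfi ν) (hlf.add herr) hpt).trans_eq ?_
  rw [integral_add' hlf herr, integral_rnDeriv_smul hac, integral_const_mul,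
    integral_add (hkl.const_mul c) hl', integral_const_mul,
    integral_div, integral_add hl (integrable_const 1), hl1, toReal_klDiv_eq_integral_klFun hac]
  simp only [integral_const, probReal_univ, smul_eq_mul]
  field_simp
  ring

variable {U K : ℕ} {b : BudgetConstraint K} (A : Learner U b) {D D' : RewardModel U K}
  {u : Fin U} {k : Fin K}

theorem ae_toReal_roundLikelihood_pos {g : ℝ → ℝ≥0∞}
    (hpos : ∀ᵐ x ∂(D.D u k), 0 < (g x).toReal) (π : Matching U K) :
    ∀ᵐ r ∂(D.rewardKernel π), 0 < (roundLikelihood u k g (π, r)).toReal := by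
  by_cases hπ : π u = k
  · simp only [roundLikelihood, hπ, if_true]
    rw [← hπ, ← D.map_eval_rewardKernel] at hpos
    exact ae_of_ae_map (measurable_pi_apply u).aemeasurable hpos
  · simp [roundLikelihood, hπ]

theorem integrable_log_roundLikelihood {g : ℝ → ℝ≥0∞}
    (hlog : Integrable (fun x => Real.log (g x).toReal) (D.D u k)) (π : Matching U K) :
    Integrable (fun r => Real.log (roundLikelihood u k g (π, r)).toReal) (D.rewardKernel π) := by
  by_cases hπ : π u = k
  · simp only [roundLikelihood, hπ, if_true]
    refine Integrable.comp_measurable (f := fun r : Fin U → ℝ => r u)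
      (g := fun x => Real.log (g x).toReal) ?_ (measurable_pi_apply u)
    rwa [D.map_eval_rewardKernel, hπ]
  · simp [roundLikelihood, hπ]

theorem integral_log_roundLikelihood {g : ℝ → ℝ≥0∞} (hg : Measurable g) (π : Matching U K) :
    ∫ r, Real.log (roundLikelihood u k g (π, r)).toReal ∂(D.rewardKernel π) =
      (if π u = k then 1 else 0) * ∫ x, Real.log (g x).toReal ∂(D.D u k) := by
  by_cases hπ : π u = k
  · simp only [roundLikelihood, hπ, if_true, one_mul]
    rw [← hπ, ← D.map_eval_rewardKernel]
    exact (integral_map (φ := fun r : Fin U → ℝ => r u) (measurable_pi_apply u).aemeasurable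
      hg.ennreal_toReal.log.aestronglyMeasurable).symm
  · simp [roundLikelihood, hπ]

theorem historyLaw_eq_withDensity_rnDeriv (hac : D.D u k ≪ D'.D u k)
    (hne : ∀ v j, (v, j) ≠ (u, k) → D.D v j = D'.D v j) (t : ℕ) :
    historyLaw A D t = (historyLaw A D' t).withDensity fun h =>
      ∏ s, roundLikelihood u k ((D.D u k).rnDeriv (D'.D u k)) (h s) :=
  have hg := Measure.measurable_rnDeriv (D.D u k) (D'.D u k)
  historyLaw_eq_withDensity A (measurable_roundLikelihood u k hg)
    (rewardKernel_eq_withDensity_roundLikelihood hg (Measure.withDensity_rnDeriv_eq _ _ hac).symm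
      hne) t

theorem llr_historyLaw_ae_eq (hac : D.D u k ≪ D'.D u k)
    (hne : ∀ v j, (v, j) ≠ (u, k) → D.D v j = D'.D v j) (t : ℕ) :
    llr (historyLaw A D t) (historyLaw A D' t) =ᵐ[historyLaw A D t] fun h =>
      ∑ s, Real.log (roundLikelihood u k ((D.D u k).rnDeriv (D'.D u k)) (h s)).toReal := by
  have hℓ := measurable_roundLikelihood u k (Measure.measurable_rnDeriv (D.D u k) (D'.D u k))
  have hlaw := historyLaw_eq_withDensity_rnDeriv A hac hne t
  have hrn : (historyLaw A D t).rnDeriv (historyLaw A D' t) =ᵐ[historyLaw A D' t] fun h =>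
      ∏ s, roundLikelihood u k ((D.D u k).rnDeriv (D'.D u k)) (h s) := by
    rw [hlaw]
    exact Measure.rnDeriv_withDensity _ (measurable_prod_rounds hℓ t)
  have hacH : historyLaw A D t ≪ historyLaw A D' t := by
    rw [hlaw]
    exact withDensity_absolutelyContinuous _ _
  have hg : ∀ᵐ x ∂(D.D u k), 0 < ((D.D u k).rnDeriv (D'.D u k) x).toReal := by
    filter_upwards [Measure.rnDeriv_pos hac,
      hac.ae_le (Measure.rnDeriv_ne_top (D.D u k) (D'.D u k))] with x h0 htop
      using ENNReal.toReal_pos h0.ne' htop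
  have hpos := ae_all_iff.2 fun s : Fin t => ae_round_historyLaw A D
    (measurableSet_lt measurable_const hℓ.ennreal_toReal) (ae_toReal_roundLikelihood_pos hg) s
  filter_upwards [hacH.ae_le hrn, hpos] with h hh hp
  simp only [llr_def]
  rw [hh, ENNReal.toReal_prod, Real.log_prod fun s _ => (hp s).ne']

theorem klDiv_historyLaw (hfin : klDiv (D.D u k) (D'.D u k) ≠ ∞)
    (hne : ∀ v j, (v, j) ≠ (u, k) → D.D v j = D'.D v j) (t : ℕ) :
    klDiv (historyLaw A D t) (historyLaw A D' t) ≠ ∞ ∧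
      (klDiv (historyLaw A D t) (historyLaw A D' t)).toReal =
        (∫ h, (pullCount h u k : ℝ) ∂(historyLaw A D t)) *
          (klDiv (D.D u k) (D'.D u k)).toReal := by
  obtain ⟨hac, hllr⟩ := klDiv_ne_top_iff.1 hfin
  have hg := Measure.measurable_rnDeriv (D.D u k) (D'.D u k)
  have hlog : Measurable fun x : Round U K =>
      Real.log (roundLikelihood u k ((D.D u k).rnDeriv (D'.D u k)) x).toReal :=
    (measurable_roundLikelihood u k hg).ennreal_toReal.log
  have hae := llr_historyLaw_ae_eq A hac hne t
  have hacH : historyLaw A D t ≪ historyLaw A D' t := by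
    rw [historyLaw_eq_withDensity_rnDeriv A hac hne t]
    exact withDensity_absolutelyContinuous _ _
  refine ⟨klDiv_ne_top hacH ((integrable_finsetSum _ fun s _ =>
    integrable_round A D hlog (integrable_log_roundLikelihood hllr) s).congr hae.symm), ?_⟩
  calc (klDiv (historyLaw A D t) (historyLaw A D' t)).toReal
      = ∫ h, ∑ s, Real.log
          (roundLikelihood u k ((D.D u k).rnDeriv (D'.D u k)) (h s)).toReal
          ∂(historyLaw A D t) := by
        rw [toReal_klDiv_of_measure_eq hacH (by simp), integral_congr_ae hae]
    _ = ∫ h, (pullCount h u k : ℝ) * (klDiv (D.D u k) (D'.D u k)).toReal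
          ∂(historyLaw A D t) := by
        rw [integral_sum_round A D hlog (integrable_log_roundLikelihood hllr),
          toReal_klDiv_of_measure_eq hac (by simp)]
        simp_rw [integral_log_roundLikelihood hg, ← Finset.sum_mul, pullCount_eq_sum]
        simp [llr_def]
    _ = _ := integral_mul_const _ _

theorem integral_pullCount_le_add_klDiv (hfin : klDiv (D.D u k) (D'.D u k) ≠ ∞)
    (hne : ∀ v j, (v, j) ≠ (u, k) → D.D v j = D'.D v j) {c : ℝ} (hc : 0 < c) (t : ℕ) :
    ∫ h, (pullCount h u k : ℝ) ∂(historyLaw A D' t) ≤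
      ∫ h, (pullCount h u k : ℝ) ∂(historyLaw A D t) +
        t * (c * ((∫ h, (pullCount h u k : ℝ) ∂(historyLaw A D t)) *
          (klDiv (D.D u k) (D'.D u k)).toReal) + 1 / c) := by
  obtain ⟨hfinH, hklH⟩ := klDiv_historyLaw A hfin hne t
  rw [← hklH]
  exact integral_le_integral_add_klDiv hfinH
    (measurable_natCast_pullCount u k)
    (fun h => ⟨Nat.cast_nonneg _, Nat.cast_le.2 (pullCount_le h u k)⟩) hc

/-- The density of the Bernoulli law with parameter `q` relative to the Bernoulli law with
parameter `p`, for `0 < p < 1`. -/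
noncomputable def bernoulliDensity (p q x : ℝ) : ℝ≥0∞ :=
  if x = 1 then ENNReal.ofReal (q / p) else ENNReal.ofReal ((1 - q) / (1 - p))

theorem measurable_bernoulliDensity (p q : ℝ) : Measurable (bernoulliDensity p q) :=
  Measurable.ite (measurableSet_singleton 1) measurable_const measurable_const

theorem bernoulliDensity_ne_top (p q x : ℝ) : bernoulliDensity p q x ≠ ∞ := by
  unfold bernoulliDensity
  split_ifs <;> exact ENNReal.ofReal_ne_top

theorem bernoulliMeasure_eq_withDensity {p : unitInterval} (hp0 : 0 < p) (hp1 : p < 1)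
    (q : unitInterval) :
    bernoulliMeasure (1 : ℝ) 0 q = (bernoulliMeasure (1 : ℝ) 0 p).withDensity
      (bernoulliDensity p q) := by
  have hp0' : (0 : ℝ) < p := hp0
  have hp1' : (0 : ℝ) < 1 - p := sub_pos.2 hp1
  have hcoe (r : unitInterval) : (unitInterval.toNNReal r : ℝ≥0∞) = ENNReal.ofReal r := by
    rw [ENNReal.ofReal, ← unitInterval.coe_toNNReal, Real.toNNReal_coe]
  refine Measure.ext_of_lintegral _ fun f hf => ?_
  rw [lintegral_withDensity_eq_lintegral_mul _ (measurable_bernoulliDensity p q) hf]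
  simp only [bernoulliMeasure_def, lintegral_add_measure, lintegral_smul_measure, lintegral_dirac,
    Pi.mul_apply, bernoulliDensity, if_true, zero_ne_one, if_false, ENNReal.smul_def, smul_eq_mul,
    hcoe, unitInterval.coe_symm_eq, ← mul_assoc]
  rw [← ENNReal.ofReal_mul hp0'.le, ← ENNReal.ofReal_mul hp1'.le, mul_div_cancel₀ _ hp0'.ne',
    mul_div_cancel₀ _ hp1'.ne']

/- The bound is the chi-square divergence, which dominates the relative entropy since
`log x ≤ x - 1`. -/
theorem klDiv_bernoulliMeasure_le {p : unitInterval} (hp0 : 0 < p) (hp1 : p < 1)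
    (q : unitInterval) :
    klDiv (bernoulliMeasure (1 : ℝ) 0 q) (bernoulliMeasure (1 : ℝ) 0 p) ≠ ∞ ∧
      (klDiv (bernoulliMeasure (1 : ℝ) 0 q) (bernoulliMeasure (1 : ℝ) 0 p)).toReal ≤
        (p - q : ℝ) ^ 2 / (p * (1 - p)) := by
  have hp0' : (0 : ℝ) < p := hp0
  have hp1' : (0 : ℝ) < 1 - p := sub_pos.2 hp1
  have hdens := bernoulliMeasure_eq_withDensity hp0 hp1 q
  have hac : bernoulliMeasure (1 : ℝ) 0 q ≪ bernoulliMeasure (1 : ℝ) 0 p := by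
    rw [hdens]
    exact withDensity_absolutelyContinuous _ _
  have hrn : (bernoulliMeasure (1 : ℝ) 0 q).rnDeriv (bernoulliMeasure (1 : ℝ) 0 p)
      =ᵐ[bernoulliMeasure (1 : ℝ) 0 q] bernoulliDensity p q := by
    refine hac.ae_le ?_
    rw [hdens]
    exact Measure.rnDeriv_withDensity _ (measurable_bernoulliDensity p q)
  refine ⟨klDiv_ne_top hac (integrable_bernoulliMeasure _ _ _ _), ?_⟩
  have hllr : llr (bernoulliMeasure (1 : ℝ) 0 q) (bernoulliMeasure (1 : ℝ) 0 p)
      ≤ᵐ[bernoulliMeasure (1 : ℝ) 0 q] fun x => (bernoulliDensity p q x).toReal - 1 := by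
    filter_upwards [hrn, Measure.rnDeriv_pos hac] with x hx hpos
    rw [hx] at hpos
    simp only [llr_def]
    rw [hx]
    exact Real.log_le_sub_one_of_pos (ENNReal.toReal_pos hpos.ne' (bernoulliDensity_ne_top p q x))
  rw [toReal_klDiv_of_measure_eq hac (by simp)]
  refine (integral_mono_ae (integrable_bernoulliMeasure _ _ _ _)
    (integrable_bernoulliMeasure _ _ _ _) hllr).trans_eq ?_
  rw [integral_bernoulliMeasure]
  simp only [bernoulliDensity, if_true, zero_ne_one, if_false, smul_eq_mul]
  rw [ENNReal.toReal_ofReal (div_nonneg q.2.1 hp0'.le),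
    ENNReal.toReal_ofReal (div_nonneg (sub_nonneg.2 q.2.2) hp1'.le)]
  field_simp
  ring

end RelativeEntropy

/-! ### Planted instances -/

section PlantedModel

variable {U K : ℕ}

theorem ae_mem_Icc_bernoulliMeasure (p : unitInterval) :
    ∀ᵐ x ∂(bernoulliMeasure (1 : ℝ) 0 p), x ∈ Set.Icc (0 : ℝ) 1 := by
  rw [bernoulliMeasure_def, ae_add_measure_iff]
  constructor <;> refine Measure.ae_smul_measure ((ae_dirac_iff measurableSet_Icc).2 ?_) _ <;> simp

/-- The hard instances of the lower bound: all rewards are Bernoulli with parameter `q`, except that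
for each user `u` the arm `κ u`, if there is one, has the parameter `p` instead. -/
noncomputable def plantedModel (p q : unitInterval) (κ : Fin U → Option (Fin K)) :
    RewardModel U K where
  D u k := bernoulliMeasure 1 0 (if κ u = some k then p else q)
  isProb _ _ := inferInstance
  support _ _ := ae_mem_Icc_bernoulliMeasure _

theorem mean_plantedModel (p q : unitInterval) (κ : Fin U → Option (Fin K)) (u : Fin U)
    (k : Fin K) : (plantedModel p q κ).mean u k = if κ u = some k then (p : ℝ) else q := by
  simp only [RewardModel.mean, plantedModel, integral_bernoulliMeasure]
  split_ifs <;> simp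

theorem integral_pullCount_plantedModel_le {b : BudgetConstraint K} (A : Learner U b)
    {p q : unitInterval} (hp0 : 0 < p) (hp1 : p < 1) (κ : Fin U → Option (Fin K)) (u : Fin U)
    (k : Fin K) {c : ℝ} (hc : 0 < c) (t : ℕ) :
    ∫ h, (pullCount h u k : ℝ)
        ∂(historyLaw A (plantedModel p q (Function.update κ u (some k))) t) ≤
      ∫ h, (pullCount h u k : ℝ) ∂(historyLaw A (plantedModel p q (Function.update κ u none)) t) +
        t * (c * ((∫ h, (pullCount h u k : ℝ)
          ∂(historyLaw A (plantedModel p q (Function.update κ u none)) t)) *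
            ((p - q : ℝ) ^ 2 / (p * (1 - p)))) + 1 / c) := by
  obtain ⟨hfin, hkl⟩ := klDiv_bernoulliMeasure_le hp0 hp1 q
  set D := plantedModel p q (Function.update κ u none) with hD
  set D' := plantedModel p q (Function.update κ u (some k)) with hD'
  have hDu : D.D u k = bernoulliMeasure 1 0 q := by simp [hD, plantedModel]
  have hDu' : D'.D u k = bernoulliMeasure 1 0 p := by simp [hD', plantedModel]
  have hne (v : Fin U) (j : Fin K) (hvj : (v, j) ≠ (u, k)) : D.D v j = D'.D v j := by
    by_cases hv : v = u
    · subst hv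
      have hkj : k ≠ j := fun h => hvj (by rw [h])
      simp [hD, hD', plantedModel, hkj]
    · simp [hD, hD', plantedModel, hv]
  refine (integral_pullCount_le_add_klDiv A (D := D) (D' := D') (by rwa [hDu, hDu']) hne hc t).trans
    ?_
  rw [hDu, hDu']
  gcongr

end PlantedModel

/-! ### The lower bound -/

section LowerBound

variable {U K : ℕ} {b : BudgetConstraint K}

theorem sum_sum_update {ι α : Type*} [Fintype ι] [DecidableEq ι] [Fintype α] (i : ι)
    (a : (ι → α) → ℝ) :
    ∑ κ : ι → α, ∑ j, a (Function.update κ i j) = Fintype.card α * ∑ κ, a κ := by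
  let swap : (ι → α) × α → (ι → α) × α := fun x => (Function.update x.1 i x.2, x.1 i)
  have hswap : Function.Involutive swap := fun x => by simp [swap]
  have h := Equiv.sum_comp hswap.toPerm fun x => a x.1
  rw [Fintype.sum_prod_type, Fintype.sum_prod_type] at h
  simpa [swap, Function.Involutive.coe_toPerm, Finset.mul_sum] using h

theorem sum_value_sub_plantedModel (p q : unitInterval) (κ : Matching U K) {t : ℕ}
    (h : History U K t) :
    ∑ s, ((plantedModel p q (some ∘ κ)).value κ - (plantedModel p q (some ∘ κ)).value (h s).1) =
      (p - q) * (U * t - ∑ u, (pullCount h u (κ u) : ℝ)) := by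
  have hgap (π : Matching U K) : (plantedModel p q (some ∘ κ)).value κ -
      (plantedModel p q (some ∘ κ)).value π =
        ∑ u, (p - q : ℝ) * (1 - if π u = κ u then 1 else 0) := by
    rw [RewardModel.value, RewardModel.value, ← Finset.sum_sub_distrib]
    refine Finset.sum_congr rfl fun u _ => ?_
    rw [mean_plantedModel, mean_plantedModel]
    by_cases hu : π u = κ u
    · simp [hu]
    · simp [hu, Ne.symm hu]
  simp_rw [hgap]
  rw [Finset.sum_comm]
  simp_rw [← Finset.mul_sum, Finset.sum_sub_distrib, pullCount_eq_sum]
  simp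

theorem le_regret_plantedModel (A : Learner U b) (p q : unitInterval) {κ : Matching U K}
    (hκ : b.Feasible κ) (T : ℕ) :
    (p - q : ℝ) * (U * T - ∑ u, ∫ h, (pullCount h u (κ u) : ℝ)
      ∂(historyLaw A (plantedModel p q (some ∘ κ)) T)) ≤
        regret T A (plantedModel p q (some ∘ κ)) := by
  set D := plantedModel p q (some ∘ κ) with hD
  have hi (u : Fin U) := integrable_pullCount A D (t := T) u (κ u)
  calc (p - q : ℝ) * (U * T - ∑ u, ∫ h, (pullCount h u (κ u) : ℝ) ∂(historyLaw A D T))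
      = ∫ h, (p - q : ℝ) * (U * T - ∑ u, (pullCount h u (κ u) : ℝ)) ∂(historyLaw A D T) := by
        rw [integral_const_mul,
          integral_sub (integrable_const _) (integrable_finsetSum _ fun u _ => hi u),
          integral_finsetSum _ fun u _ => hi u]
        simp
    _ = ∫ h, ∑ t, (D.value κ - D.value (h t).1) ∂(historyLaw A D T) := by
        simp_rw [hD, sum_value_sub_plantedModel]
    _ ≤ ∫ h, ∑ t, (D.optValue b - D.value (h t).1) ∂(historyLaw A D T) :=
        integral_mono
          (integrable_comp_matchings A D fun m => ∑ t, (D.value κ - D.value (m t)))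
          (integrable_comp_matchings A D fun m => ∑ t, (D.optValue b - D.value (m t)))
          fun h => Finset.sum_le_sum fun t _ => sub_le_sub_right (D.value_le_optValue hκ) _
    _ = regret T A D := (regret_eq_integral_sum A D T).symm

theorem sum_integral_pullCount_plantedModel_le (A : Learner U b) {p q : unitInterval} (hp0 : 0 < p)
    (hp1 : p < 1) (κ : Matching U K) (u : Fin U) {c : ℝ} (hc : 0 < c) (T : ℕ) :
    ∑ k, ∫ h, (pullCount h u k : ℝ)
        ∂(historyLaw A (plantedModel p q (some ∘ Function.update κ u k)) T) ≤
      T + T * (c * (T * ((p - q : ℝ) ^ 2 / (p * (1 - p)))) + K / c) := by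
  set D := plantedModel p q (Function.update (some ∘ κ) u none)
  have hD : ∑ k, ∫ h, (pullCount h u k : ℝ) ∂(historyLaw A D T) = T := by
    rw [← integral_finsetSum _ fun k _ => integrable_pullCount A D u k]
    simp_rw [← Nat.cast_sum, sum_pullCount]
    simp
  calc ∑ k, ∫ h, (pullCount h u k : ℝ)
        ∂(historyLaw A (plantedModel p q (some ∘ Function.update κ u k)) T)
      ≤ ∑ k, (∫ h, (pullCount h u k : ℝ) ∂(historyLaw A D T) +
          T * (c * ((∫ h, (pullCount h u k : ℝ) ∂(historyLaw A D T)) *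
            ((p - q : ℝ) ^ 2 / (p * (1 - p)))) + 1 / c)) := by
        refine Finset.sum_le_sum fun k _ => ?_
        rw [Function.comp_update]
        exact integral_pullCount_plantedModel_le A hp0 hp1 (some ∘ κ) u k hc T
    _ = T + T * (c * (T * ((p - q : ℝ) ^ 2 / (p * (1 - p)))) + K / c) := by
        rw [Finset.sum_add_distrib, ← Finset.mul_sum, Finset.sum_add_distrib, ← Finset.mul_sum,
          ← Finset.sum_mul, hD]
        simp [div_eq_mul_inv]

theorem exists_sum_integral_pullCount_plantedModel_le (hK : 0 < K) (A : Learner U b)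
    {p q : unitInterval} (hp0 : 0 < p) (hp1 : p < 1) {c : ℝ} (hc : 0 < c) (T : ℕ) :
    ∃ κ : Matching U K, K * ∑ u, ∫ h, (pullCount h u (κ u) : ℝ)
        ∂(historyLaw A (plantedModel p q (some ∘ κ)) T) ≤
      U * (T + T * (c * (T * ((p - q : ℝ) ^ 2 / (p * (1 - p)))) + K / c)) := by
  have : NeZero K := ⟨hK.ne'⟩
  set M := (T + T * (c * (T * ((p - q : ℝ) ^ 2 / (p * (1 - p)))) + K / c) : ℝ)
  let N (u : Fin U) (κ : Matching U K) : ℝ := ∫ h, (pullCount h u (κ u) : ℝ)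
    ∂(historyLaw A (plantedModel p q (some ∘ κ)) T)
  have haverage (u : Fin U) : ∑ κ, K * N u κ ≤ ∑ _κ : Matching U K, M := by
    have h := sum_sum_update u (N u)
    rw [Fintype.card_fin] at h
    rw [← Finset.mul_sum, ← h]
    refine Finset.sum_le_sum fun κ _ => ?_
    simpa [N] using sum_integral_pullCount_plantedModel_le A hp0 hp1 κ u hc T
  obtain ⟨κ, -, hκ⟩ : ∃ κ ∈ (Finset.univ : Finset (Matching U K)),
      ∑ u, K * N u κ ≤ ∑ _u : Fin U, M := by
    refine Finset.exists_le_of_sum_le Finset.univ_nonempty ?_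
    rw [Finset.sum_comm, Finset.sum_comm (s := (Finset.univ : Finset (Matching U K)))]
    exact Finset.sum_le_sum fun u _ => haverage u
  exact ⟨κ, by simpa [N, Finset.mul_sum] using hκ⟩

/-- The constraint without costs, for which every matching is feasible. -/
def freeConstraint (K : ℕ) : BudgetConstraint K where
  cost _ := 0
  budget := 0
  cost_le _ := by simp

theorem feasible_freeConstraint (π : Matching U K) : (freeConstraint K).Feasible π := by
  simp [BudgetConstraint.Feasible, freeConstraint]

theorem exists_gap_eq_sqrt_and_chiSq_le {x T : ℝ} (hx : 0 ≤ x) (hT : 0 < T) (hxT : x ≤ T) :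
    ∃ p q : unitInterval, 0 < p ∧ p < 1 ∧ (p - q) * T = √(x * T) / 16 ∧
      T * ((p - q : ℝ) ^ 2 / (p * (1 - p))) ≤ x / 48 := by
  have hsqrt_le : √(x / T) ≤ 1 := Real.sqrt_le_one.2 ((div_le_one hT).2 hxT)
  obtain ⟨e, he⟩ : ∃ e : ℝ, e = √(x / T) / 16 := ⟨_, rfl⟩
  have he0 : 0 ≤ e := by rw [he]; positivity
  have he1 : e ≤ 1 / 16 := by rw [he]; linarith
  have heT : 256 * e ^ 2 * T = x := by
    rw [he, div_pow, Real.sq_sqrt (by positivity)]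
    field_simp
    ring
  have hsqrt : √(x * T) = √(x / T) * T := by
    rw [show x * T = x / T * T ^ 2 by field_simp, Real.sqrt_mul (by positivity),
      Real.sqrt_sq hT.le]
  have hχ : T * ((1 / 2 + e - 1 / 2) ^ 2 / ((1 / 2 + e) * (1 - (1 / 2 + e)))) ≤ x / 48 := by
    rw [← mul_div_assoc, div_le_iff₀ (mul_pos (by linarith) (by linarith)), ← heT]
    nlinarith [mul_nonneg (mul_nonneg (sq_nonneg e) hT.le) (by nlinarith : 0 ≤ 1 / 16 - e ^ 2)]
  exact ⟨⟨1 / 2 + e, by linarith, by linarith⟩, ⟨1 / 2, by norm_num, by norm_num⟩,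
    Subtype.mk_lt_mk.2 (by linarith), Subtype.mk_lt_mk.2 (by linarith [he1]),
    by linear_combination T * he - hsqrt / 16, hχ⟩

theorem exists_le_regret_freeConstraint {T : ℕ} (hK : 2 ≤ K) (hKT : K ≤ T)
    (A : Learner U (freeConstraint K)) :
    ∃ D : RewardModel U K, 1 / 96 * (U * √(K * T)) ≤ regret T A D := by
  have hK' : (2 : ℝ) ≤ K := by exact_mod_cast hK
  have hKT' : (K : ℝ) ≤ T := by exact_mod_cast hKT
  obtain ⟨p, q, hp0, hp1, hgap, hχ⟩ :=
    exists_gap_eq_sqrt_and_chiSq_le (x := K) (T := T) (by linarith) (by linarith) hKT'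
  obtain ⟨κ, hκ⟩ := exists_sum_integral_pullCount_plantedModel_le (by omega) A (q := q) hp0 hp1
    (c := 8) (by norm_num) T
  refine ⟨_, le_trans ?_ (le_regret_plantedModel A p q (feasible_freeConstraint κ) T)⟩
  set N := ∑ u, ∫ h, (pullCount h u (κ u) : ℝ) ∂(historyLaw A (plantedModel p q (some ∘ κ)) T)
  have hN : N ≤ 5 / 6 * (U * T) := by
    refine le_of_mul_le_mul_left (hκ.trans ?_) (by linarith : (0 : ℝ) < K)
    calc U * (T + T * (8 * (T * ((p - q : ℝ) ^ 2 / (p * (1 - p)))) + K / 8))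
        ≤ U * (T * (K / 2) + T * (8 * (K / 48) + K / 8)) := by gcongr; nlinarith
      _ ≤ K * (5 / 6 * (U * T)) := by
        nlinarith [mul_nonneg (mul_nonneg U.cast_nonneg T.cast_nonneg) (by linarith : (0 : ℝ) ≤ K)]
  have hgap0 : (0 : ℝ) ≤ p - q :=
    nonneg_of_mul_nonneg_left (hgap ▸ by positivity) (by linarith : (0 : ℝ) < T)
  calc 1 / 96 * (U * √(K * T)) = (p - q) * (U * T - 5 / 6 * (U * T)) := by
        linear_combination (-(U : ℝ) / 6) * hgap
    _ ≤ (p - q) * (U * T - N) := by gcongr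

end LowerBound

/-! ### Concentration of the empirical means -/

section Concentration

variable {U K t : ℕ} {b : BudgetConstraint K} (A : Learner U b) (D : RewardModel U K)

theorem pullCount_mul_empMean (h : History U K t) (u : Fin U) (k : Fin K) :
    pullCount h u k * empMean h u k = ∑ s, if (h s).1 u = k then (h s).2 u else 0 := by
  rw [← Finset.sum_filter, empMean]
  rcases eq_or_ne (pullCount h u k) 0 with h0 | h0
  · rw [Finset.card_eq_zero.1 h0]
    simp
  · exact mul_div_cancel₀ _ (Nat.cast_ne_zero.2 h0)

theorem measurable_empMean (u : Fin U) (k : Fin K) :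
    Measurable fun h : History U K t => empMean h u k := by
  have hassigned (s : Fin t) : MeasurableSet {h : History U K t | (h s).1 u = k} :=
    measurable_comp_matchings (fun m => m s u) (measurableSet_singleton k)
  simp only [empMean, Finset.sum_filter]
  exact (Finset.measurable_sum _ fun s _ => Measurable.ite (hassigned s) (by fun_prop)
    measurable_const).div (measurable_natCast_pullCount u k)

/-- The exponential likelihood ratio `exp (l * (x - θ) - l ^ 2 / 8)`, which by Hoeffding's lemma
has mass at most one under every law on `[0, 1]` with mean `θ`. -/
noncomputable def hoeffdingTilt (θ l x : ℝ) : ℝ≥0∞ :=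
  ENNReal.ofReal (Real.exp (l * (x - θ) - l ^ 2 / 8))

theorem measurable_hoeffdingTilt (θ l : ℝ) : Measurable (hoeffdingTilt θ l) := by
  unfold hoeffdingTilt
  fun_prop

theorem lintegral_hoeffdingTilt_le_one {μ : Measure ℝ} [IsProbabilityMeasure μ]
    (hμ : ∀ᵐ x ∂μ, x ∈ Set.Icc (0 : ℝ) 1) (l : ℝ) :
    ∫⁻ x, hoeffdingTilt (∫ y, y ∂μ) l x ∂μ ≤ 1 := by
  have hsub : HasSubgaussianMGF (fun x => x - ∫ y, y ∂μ) _ μ :=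
    hasSubgaussianMGF_of_mem_Icc aemeasurable_id hμ
  have hexp (x : ℝ) : Real.exp (l * (x - ∫ y, y ∂μ) - l ^ 2 / 8) =
      Real.exp (l * (x - ∫ y, y ∂μ)) / Real.exp (l ^ 2 / 8) := Real.exp_sub _ _
  simp only [hoeffdingTilt, hexp]
  rw [← ofReal_integral_eq_lintegral_ofReal ((hsub.integrable_exp_mul l).div_const _)
    (.of_forall fun x => by positivity), ENNReal.ofReal_le_one, integral_div,
    div_le_one (Real.exp_pos _)]
  refine (hsub.mgf_le l).trans_eq (congrArg Real.exp ?_)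
  simp
  ring

theorem prod_roundLikelihood_hoeffdingTilt (h : History U K t) (u : Fin U) (k : Fin K)
    (θ l : ℝ) :
    ∏ s, roundLikelihood u k (hoeffdingTilt θ l) (h s) =
      ENNReal.ofReal (Real.exp (pullCount h u k * (l * (empMean h u k - θ) - l ^ 2 / 8))) := by
  have hround (s : Fin t) : roundLikelihood u k (hoeffdingTilt θ l) (h s) =
      ENNReal.ofReal (Real.exp (l * (if (h s).1 u = k then (h s).2 u else 0) -
        (if (h s).1 u = k then 1 else 0) * (l * θ + l ^ 2 / 8))) := by
    unfold roundLikelihood hoeffdingTilt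
    split_ifs
    · ring_nf
    · simp
  simp only [hround]
  rw [← ENNReal.ofReal_prod_of_nonneg fun s _ => (Real.exp_pos _).le, ← Real.exp_sum,
    Finset.sum_sub_distrib, ← Finset.mul_sum, ← Finset.sum_mul, ← pullCount_mul_empMean]
  have hcount : ∑ s, (if (h s).1 u = k then 1 else 0 : ℝ) = pullCount h u k := by
    simp [pullCount_eq_sum]
  rw [hcount]
  ring_nf

theorem measureReal_pullCount_eq_and_le_mul_le (u : Fin U) (k : Fin K) (n : ℕ) (l c : ℝ) :
    (historyLaw A D t).real
        {h | pullCount h u k = n ∧ c ≤ l * (empMean h u k - D.mean u k)} ≤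
      Real.exp (-(n * (c - l ^ 2 / 8))) := by
  set ℓ := roundLikelihood u k (hoeffdingTilt (D.mean u k) l)
  have hℓ : Measurable ℓ := measurable_roundLikelihood u k (measurable_hoeffdingTilt _ _)
  have hmass : ∫⁻ h, ∏ s, ℓ (h s) ∂(historyLaw A D t) ≤ 1 :=
    lintegral_prod_rounds_le_one A hℓ (lintegral_roundLikelihood_le_one
      (measurable_hoeffdingTilt _ _) (lintegral_hoeffdingTilt_le_one (D.support u k) l)) t
  refine ENNReal.toReal_le_of_le_ofReal (Real.exp_pos _).le ?_
  calc historyLaw A D t {h | pullCount h u k = n ∧ c ≤ l * (empMean h u k - D.mean u k)}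
      ≤ historyLaw A D t {h | ENNReal.ofReal (Real.exp (n * (c - l ^ 2 / 8))) ≤ ∏ s, ℓ (h s)} := by
        refine measure_mono fun h hh => ?_
        change _ ≤ ∏ s, ℓ (h s)
        rw [prod_roundLikelihood_hoeffdingTilt, hh.1]
        gcongr
        exact hh.2
    _ ≤ 1 / ENNReal.ofReal (Real.exp (n * (c - l ^ 2 / 8))) :=
        (meas_ge_le_lintegral_div (measurable_prod_rounds hℓ t).aemeasurable
          (by simpa using Real.exp_pos _) ENNReal.ofReal_ne_top).trans
          (ENNReal.div_le_div_right hmass _)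
    _ = ENNReal.ofReal (Real.exp (-(n * (c - l ^ 2 / 8)))) := by
        rw [Real.exp_neg, ENNReal.ofReal_inv_of_pos (Real.exp_pos _), one_div]

theorem measureReal_pullCount_eq_and_lt_abs_le (u : Fin U) (k : Fin K) (n : ℕ) {r : ℝ}
    (hr : 0 ≤ r) :
    (historyLaw A D t).real {h | pullCount h u k = n ∧ r < |empMean h u k - D.mean u k|} ≤
      2 * Real.exp (-(2 * n * r ^ 2)) := by
  have htail (l : ℝ) (hl : l ^ 2 = 16 * r ^ 2) : (historyLaw A D t).real
      {h | pullCount h u k = n ∧ 4 * r ^ 2 ≤ l * (empMean h u k - D.mean u k)} ≤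
        Real.exp (-(2 * n * r ^ 2)) :=
    (measureReal_pullCount_eq_and_le_mul_le A D u k n l (4 * r ^ 2)).trans_eq (by rw [hl]; ring_nf)
  refine (measureReal_mono (s₂ := {h | pullCount h u k = n ∧ 4 * r ^ 2 ≤
      4 * r * (empMean h u k - D.mean u k)} ∪ {h | pullCount h u k = n ∧ 4 * r ^ 2 ≤
      -(4 * r) * (empMean h u k - D.mean u k)}) ?_).trans ((measureReal_union_le _ _).trans ?_)
  · rintro h ⟨hn, hdev⟩
    rcases lt_abs.1 hdev with hdev | hdev
    · exact Or.inl ⟨hn, by nlinarith⟩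
    · exact Or.inr ⟨hn, by nlinarith⟩
  · linarith [htail (4 * r) (by ring), htail (-(4 * r)) (by ring)]

/-- Every pair that has been tried has its mean reward within the confidence width of its
empirical mean. -/
def WithinConfidence (T : ℕ) (D : RewardModel U K) (h : History U K t) : Prop :=
  ∀ u k, 0 < pullCount h u k →
    |empMean h u k - D.mean u k| ≤ √(2 * Real.log T / pullCount h u k)

theorem measurableSet_withinConfidence (T : ℕ) :
    MeasurableSet {h : History U K t | WithinConfidence T D h} := by
  simp only [WithinConfidence, Set.ofPred_forall]
  refine MeasurableSet.iInter fun u => MeasurableSet.iInter fun k => ?_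
  refine MeasurableSet.imp (measurableSet_lt measurable_const (measurable_pullCount u k)) ?_
  exact measurableSet_le ((measurable_empMean u k).sub_const _).abs
    (measurable_const.div (measurable_natCast_pullCount u k)).sqrt

theorem measureReal_not_withinConfidence_le {T : ℕ} (htT : t ≤ T) (hU : U ≤ T) (hK : K ≤ T) :
    (historyLaw A D t).real {h | ¬WithinConfidence T D h} ≤ 2 / T := by
  rcases T.eq_zero_or_pos with rfl | hT
  · obtain rfl := Nat.le_zero.1 hU
    simp [WithinConfidence]
  have hT' : (0 : ℝ) < T := by exact_mod_cast hT
  let E (i : Fin U × Fin K × ℕ) : Set (History U K t) :=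
    {h | pullCount h i.1 i.2.1 = i.2.2 ∧
      √(2 * Real.log T / i.2.2) < |empMean h i.1 i.2.1 - D.mean i.1 i.2.1|}
  let I : Finset (Fin U × Fin K × ℕ) := Finset.univ ×ˢ Finset.univ ×ˢ Finset.Icc 1 t
  have hcover : {h : History U K t | ¬WithinConfidence T D h} ⊆ ⋃ i ∈ I, E i := by
    intro h hh
    simp only [WithinConfidence, Set.mem_ofPred_eq] at hh
    push Not at hh
    obtain ⟨u, k, hpos, hdev⟩ := hh
    exact Set.mem_biUnion (x := (u, k, pullCount h u k))
      (by simp [I, pullCount_le]; omega) ⟨rfl, hdev⟩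
  have hE (i) (hi : i ∈ I) : (historyLaw A D t).real (E i) ≤ 2 / T ^ 4 := by
    have hn : (0 : ℝ) < i.2.2 := by
      have := (Finset.mem_Icc.1 (Finset.mem_product.1 (Finset.mem_product.1 hi).2).2).1
      exact_mod_cast this
    refine (measureReal_pullCount_eq_and_lt_abs_le A D _ _ _ (Real.sqrt_nonneg _)).trans_eq ?_
    rw [Real.sq_sqrt (div_nonneg (by positivity) hn.le),
      show -(2 * i.2.2 * (2 * Real.log T / i.2.2)) = -((4 : ℕ) * Real.log T) by
        push_cast; field_simp; ring,
      Real.exp_neg, Real.exp_nat_mul, Real.exp_log hT', ← div_eq_mul_inv]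
  calc (historyLaw A D t).real {h | ¬WithinConfidence T D h}
      ≤ ∑ i ∈ I, (historyLaw A D t).real (E i) :=
        (measureReal_mono hcover (measure_ne_top _ _)).trans (measureReal_biUnion_finset_le _ _)
    _ ≤ U * (K * t) * (2 / T ^ 4) := by
        refine (Finset.sum_le_card_nsmul _ _ _ hE).trans_eq ?_
        simp [I]
    _ ≤ T * (T * T) * (2 / T ^ 4) := by gcongr
    _ = 2 / T := by field_simp

end Concentration

/-! ### Optimistic choices -/

section OptimisticChoice

theorem exists_measurable_forall_of_countable {α β : Type*} [MeasurableSpace α]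
    [MeasurableSpace β] [Countable β] {p : α → β → Prop}
    (hp : ∀ y, MeasurableSet {x | p x y}) (h : ∀ x, ∃ y, p x y) :
    ∃ f : α → β, Measurable f ∧ ∀ x, p x (f x) := by
  classical
  rcases isEmpty_or_nonempty α with _ | ⟨⟨x₀⟩⟩
  · exact ⟨isEmptyElim, measurable_of_empty _, isEmptyElim⟩
  have : Nonempty β := (h x₀).nonempty
  obtain ⟨e, he⟩ := exists_surjective_nat β
  have hex (x : α) : ∃ n, p x (e n) := he.exists.1 (h x)
  exact ⟨fun x => e (Nat.find (hex x)),
    (measurable_of_countable e).comp (measurable_find hex fun n => hp (e n)),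
    fun x => Nat.find_spec (hex x)⟩

variable {U K t : ℕ} {b : BudgetConstraint K}

theorem BudgetConstraint.feasible_const (b : BudgetConstraint K) (k : Fin K) :
    b.Feasible (fun _ : Fin U => k) :=
  calc ∑ j ∈ Finset.univ.image (fun _ : Fin U => k), b.cost j
      ≤ ∑ j ∈ {k}, b.cost j := Finset.sum_le_sum_of_subset (Finset.image_subset_iff.2 (by simp))
    _ ≤ b.budget := by simpa using b.cost_le k

theorem ucbValue_eq_top (T : ℕ) {h : History U K t} {π : Matching U K}
    (hπ : untriedCount h π ≠ 0) : ucbValue T h π = ⊤ := by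
  obtain ⟨u, hu⟩ := Finset.card_ne_zero.1 hπ
  have hucb : ucb T h u (π u) = ⊤ := by simp [ucb, (Finset.mem_filter.1 hu).2]
  have hrest : ∑ v ∈ Finset.univ.erase u, ucb T h v (π v) ≠ ⊥ :=
    Finset.sum_induction _ (· ≠ ⊥) (fun _ _ hx hy => EReal.add_ne_bot_iff.2 ⟨hx, hy⟩)
      EReal.zero_ne_bot fun v _ => by unfold ucb; split_ifs <;> simp
  rw [ucbValue, ← Finset.add_sum_erase _ _ (Finset.mem_univ u), hucb,
    EReal.top_add_of_ne_bot hrest]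

theorem exists_isOptimisticChoice (b : BudgetConstraint K) (hK : 1 ≤ K) (T : ℕ)
    (h : History U K t) : ∃ π, IsOptimisticChoice b T h π := by
  obtain ⟨m, hm, hmax⟩ := Set.exists_max_image {π : Matching U K | b.Feasible π}
    (untriedCount h) (Set.toFinite _) ⟨_, b.feasible_const ⟨0, hK⟩⟩
  obtain ⟨π, ⟨hπ, hπm⟩, hπmax⟩ := Set.exists_max_image
    {π : Matching U K | b.Feasible π ∧ untriedCount h π = untriedCount h m}
    (ucbValue T h) (Set.toFinite _) ⟨m, hm, rfl⟩
  refine ⟨π, hπ, fun π' hπ' => ?_, fun π' hπ' => hπm ▸ hmax π' hπ'⟩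
  rcases eq_or_ne (untriedCount h π) 0 with h0 | h0
  · exact hπmax π' ⟨hπ', le_antisymm (hmax π' hπ') (by omega)⟩
  · exact ucbValue_eq_top T h0 ▸ le_top

theorem measurable_ucbValue (T : ℕ) (π : Matching U K) :
    Measurable fun h : History U K t => ucbValue T h π := by
  refine Finset.measurable_sum _ fun u _ => Measurable.ite
    (measurableSet_lt measurable_const (measurable_pullCount u (π u))) ?_ measurable_const
  exact ((measurable_empMean u (π u)).add
    (measurable_const.div (measurable_natCast_pullCount u (π u))).sqrt).coe_real_ereal

theorem measurable_untriedCount (π : Matching U K) :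
    Measurable fun h : History U K t => untriedCount h π :=
  measurable_comp_matchings fun m : Fin t → Matching U K =>
    (Finset.univ.filter fun u => (Finset.univ.filter fun s => m s u = π u).card = 0).card

theorem measurableSet_isOptimisticChoice (b : BudgetConstraint K) (T : ℕ) (π : Matching U K) :
    MeasurableSet {h : History U K t | IsOptimisticChoice b T h π} := by
  simp only [IsOptimisticChoice, Set.ofPred_and, Set.ofPred_forall]
  refine (MeasurableSet.const _).inter (.inter ?_ ?_)
  · exact .iInter fun π' => .iInter fun _ =>
      measurableSet_le (measurable_ucbValue T π') (measurable_ucbValue T π)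
  · exact .iInter fun π' => .iInter fun _ =>
      measurableSet_le (measurable_untriedCount π') (measurable_untriedCount π)

theorem exists_isCUCB (b : BudgetConstraint K) (hK : 1 ≤ K) (T : ℕ) :
    ∃ A : Learner U b, IsCUCB T A := by
  choose f hf hopt using fun t => exists_measurable_forall_of_countable
    (measurableSet_isOptimisticChoice (U := U) (t := t) b T) (exists_isOptimisticChoice b hK T)
  refine ⟨{ policy := fun t => Kernel.deterministic (f t) (hf t)
            isMarkov := fun t => inferInstance
            feasible := fun t h => ?_ }, fun t _ h => ?_⟩
  · rw [Kernel.deterministic_apply, ae_dirac_eq]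
    exact (hopt t h).1
  · rw [Kernel.deterministic_apply, ae_dirac_eq]
    exact hopt t h

theorem ae_stepLaw_isOptimisticChoice {A : Learner U b} {T : ℕ} (hA : IsCUCB T A)
    (D : RewardModel U K) (ht : t < T) :
    ∀ᵐ x ∂(stepLaw A D t), IsOptimisticChoice b T x.1 x.2.1 := by
  refine ae_stepLaw_of_ae_policy A D (p := IsOptimisticChoice b T) ?_ (hA t ht)
  exact measurableSet_setOfPred.2 (measurable_from_prod_countable_left fun π =>
    measurableSet_setOfPred.1 (measurableSet_isOptimisticChoice b T π))

end OptimisticChoice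

/-! ### The exploration phase -/

section Exploration

variable {U K t : ℕ} {b : BudgetConstraint K}

/-- The number of user-arm pairs that have not been tried yet. -/
def untriedPairs (h : History U K t) : ℕ :=
  ∑ u, (Finset.univ.filter fun k => pullCount h u k = 0).card

theorem measurable_natCast_untriedPairs :
    Measurable fun h : History U K t => (untriedPairs h : ℝ) :=
  measurable_comp_matchings fun m : Fin t → Matching U K => ((∑ u, (Finset.univ.filter fun k =>
    (Finset.univ.filter fun s => m s u = k).card = 0).card : ℕ) : ℝ)

theorem untriedPairs_appendRound (x : History U K t × Round U K) :
    untriedPairs (appendRound x) + untriedCount x.1 x.2.1 = untriedPairs x.1 := by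
  simp only [untriedPairs, untriedCount, Finset.card_filter, ← Finset.sum_add_distrib]
  refine Finset.sum_congr rfl fun u _ => ?_
  have hassigned : (if pullCount x.1 u (x.2.1 u) = 0 then 1 else 0) =
      ∑ k, if x.2.1 u = k then (if pullCount x.1 u k = 0 then 1 else 0) else 0 := by simp
  rw [hassigned, ← Finset.sum_add_distrib]
  refine Finset.sum_congr rfl fun k _ => ?_
  rw [pullCount_appendRound]
  by_cases hk : x.2.1 u = k <;> simp [hk]

theorem untriedPairs_le_mul_untriedCount {T : ℕ} {h : History U K t} {π : Matching U K}
    (hπ : IsOptimisticChoice b T h π) : untriedPairs h ≤ K * untriedCount h π :=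
  calc untriedPairs h = ∑ k, untriedCount h (fun _ => k) := by
        simp only [untriedPairs, untriedCount, Finset.card_filter]
        exact Finset.sum_comm
    _ ≤ ∑ _k : Fin K, untriedCount h π :=
        Finset.sum_le_sum fun k _ => hπ.2.2 _ (b.feasible_const k)
    _ = K * untriedCount h π := by simp

theorem ae_untriedPairs_le {A : Learner U b} {T : ℕ} (hA : IsCUCB T A) (D : RewardModel U K)
    (hK : 1 ≤ K) (ht : t ≤ T) :
    ∀ᵐ h ∂(historyLaw A D t), (untriedPairs h : ℝ) ≤ U * K * (1 - 1 / K : ℝ) ^ t := by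
  have hK' : (1 : ℝ) ≤ K := by exact_mod_cast hK
  induction t with
  | zero => exact .of_forall fun h => by simp [untriedPairs, pullCount]
  | succ t ih =>
    rw [historyLaw_succ, ae_map_iff measurable_appendRound.aemeasurable
      (measurableSet_le measurable_natCast_untriedPairs measurable_const)]
    have hfst := ae_of_ae_map measurable_fst.aemeasurable (map_fst_stepLaw A D ▸ ih (by omega))
    filter_upwards [hfst, ae_stepLaw_isOptimisticChoice hA D ht] with x hx hopt
    have hdrop : (untriedPairs (appendRound x) : ℝ) + untriedCount x.1 x.2.1 =
        untriedPairs x.1 := by exact_mod_cast untriedPairs_appendRound x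
    have hgreedy : (untriedPairs x.1 : ℝ) / K ≤ untriedCount x.1 x.2.1 := by
      rw [div_le_iff₀' (by linarith)]
      exact_mod_cast untriedPairs_le_mul_untriedCount hopt
    have hrate : (0 : ℝ) ≤ 1 - 1 / K := sub_nonneg.2 ((div_le_one (by linarith)).2 hK')
    calc (untriedPairs (appendRound x) : ℝ) ≤ untriedPairs x.1 * (1 - 1 / K) := by
          rw [mul_one_sub, mul_one_div]
          linarith
      _ ≤ U * K * (1 - 1 / K : ℝ) ^ t * (1 - 1 / K) := mul_le_mul_of_nonneg_right hx hrate
      _ = U * K * (1 - 1 / K : ℝ) ^ (t + 1) := by ring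

theorem mul_one_sub_one_div_pow_lt_one {x y k : ℝ} (hxy : x ≤ y ^ 2) (hy : 0 < y) (hk : 1 ≤ k)
    (ht : 2 * k * Real.log y < t) : x * (1 - 1 / k) ^ t < 1 := by
  have hk0 : 0 < k := by linarith
  have hrate : 0 ≤ 1 - 1 / k := sub_nonneg.2 ((div_le_one hk0).2 hk)
  have hdecay : (1 - 1 / k) ^ t < (y ^ 2)⁻¹ :=
    calc (1 - 1 / k) ^ t ≤ Real.exp (-(1 / k)) ^ t :=
          pow_le_pow_left₀ hrate (Real.one_sub_le_exp_neg _) t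
      _ = Real.exp (-(t / k)) := by rw [← Real.exp_nat_mul]; ring_nf
      _ < Real.exp (-((2 : ℕ) * Real.log y)) := by
          rw [Real.exp_lt_exp, neg_lt_neg_iff, lt_div_iff₀ hk0]
          push_cast
          linarith
      _ = (y ^ 2)⁻¹ := by rw [Real.exp_neg, Real.exp_nat_mul, Real.exp_log hy]
  calc x * (1 - 1 / k) ^ t ≤ y ^ 2 * (1 - 1 / k) ^ t := by gcongr
    _ < y ^ 2 * (y ^ 2)⁻¹ := by gcongr
    _ = 1 := mul_inv_cancel₀ (by positivity)

theorem ae_pullCount_pos {A : Learner U b} {T : ℕ} (hA : IsCUCB T A) (D : RewardModel U K)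
    (hU : U ≤ T) (hK : 1 ≤ K) (hKT : K ≤ T) (ht : t ≤ T) (hlog : 2 * K * Real.log T < t) :
    ∀ᵐ h ∂(historyLaw A D t), ∀ u k, 0 < pullCount h u k := by
  have hUK : (U * K : ℝ) ≤ T ^ 2 := by
    rw [sq]
    gcongr
  filter_upwards [ae_untriedPairs_le hA D hK ht] with h hh u k
  have hnone : untriedPairs h = 0 := Nat.lt_one_iff.1 (by
    have := hh.trans_lt (mul_one_sub_one_div_pow_lt_one hUK (by exact_mod_cast hK.trans hKT)
      (by exact_mod_cast hK) hlog)
    exact_mod_cast this)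
  have hempty := Finset.card_eq_zero.1 (Finset.sum_eq_zero_iff.1 hnone u (Finset.mem_univ u))
  exact Nat.pos_of_ne_zero (Finset.filter_eq_empty_iff.1 hempty (Finset.mem_univ k))

end Exploration

/-! ### The regret of optimistic choices -/

section WidthPotential

variable {U K t : ℕ} {b : BudgetConstraint K} (D : RewardModel U K)

theorem ucbValue_eq_coe (T : ℕ) {h : History U K t} (hpos : ∀ u k, 0 < pullCount h u k)
    (π : Matching U K) :
    ucbValue T h π =
      (∑ u, (empMean h u (π u) + √(2 * Real.log T / pullCount h u (π u))) : ℝ) := by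
  let coe : ℝ →+ EReal := ⟨⟨Real.toEReal, EReal.coe_zero⟩, EReal.coe_add⟩
  refine (Finset.sum_congr rfl fun u _ => ?_).trans (map_sum coe _ _).symm
  exact if_pos (hpos u (π u))

theorem optValue_sub_value_le_of_isOptimisticChoice {T : ℕ} {h : History U K t}
    {π : Matching U K} (hπ : IsOptimisticChoice b T h π) (hpos : ∀ u k, 0 < pullCount h u k)
    (hconf : WithinConfidence T D h) :
    D.optValue b - D.value π ≤ ∑ u, 2 * √(2 * Real.log T / pullCount h u (π u)) := by
  let P (π' : Matching U K) : ℝ :=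
    ∑ u, (empMean h u (π' u) + √(2 * Real.log T / pullCount h u (π' u)))
  have hvalue_le (π' : Matching U K) : D.value π' ≤ P π' := Finset.sum_le_sum fun u _ => by
    linarith [(abs_le.1 (hconf u (π' u) (hpos u _))).1]
  have hmax (π' : Matching U K) (hπ' : b.Feasible π') : P π' ≤ P π := by
    have := hπ.2.1 π' hπ'
    rwa [ucbValue_eq_coe T hpos, ucbValue_eq_coe T hpos, EReal.coe_le_coe_iff] at this
  have hopt : D.optValue b ≤ P π :=
    have : Nonempty {π : Matching U K // b.Feasible π} := ⟨⟨π, hπ.1⟩⟩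
    ciSup_le fun π' => (hvalue_le π'.1).trans (hmax π'.1 π'.2)
  have hP : P π ≤ D.value π + ∑ u, 2 * √(2 * Real.log T / pullCount h u (π u)) := by
    rw [RewardModel.value, ← Finset.sum_add_distrib]
    exact Finset.sum_le_sum fun u _ => by linarith [(abs_le.1 (hconf u (π u) (hpos u _))).2]
  linarith

/-- The potential whose increments pay for the confidence widths: since `√(n + 1) - √n` is of
order `1 / √n`, one round raises it by about half the sum of the `1 / √n` over the users. -/
noncomputable def widthPotential (h : History U K t) : ℝ :=
  ∑ u, ∑ k, √(pullCount h u k)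

theorem widthPotential_le (h : History U K t) : widthPotential h ≤ U * √(K * t) :=
  calc widthPotential h ≤ ∑ _u : Fin U, √(K * t) := by
        refine Finset.sum_le_sum fun u _ => Real.le_sqrt_of_sq_le ?_
        refine sq_sum_le_card_mul_sum_sq.trans_eq ?_
        simp only [Real.sq_sqrt (Nat.cast_nonneg _), ← Nat.cast_sum, sum_pullCount,
          Finset.card_univ, Fintype.card_fin]
    _ = U * √(K * t) := by simp

theorem widthPotential_appendRound (x : History U K t × Round U K) :
    widthPotential (appendRound x) = widthPotential x.1 +
      ∑ u, (√(pullCount x.1 u (x.2.1 u) + 1) - √(pullCount x.1 u (x.2.1 u))) := by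
  simp only [widthPotential, ← Finset.sum_add_distrib]
  refine Finset.sum_congr rfl fun u _ => ?_
  rw [← sub_eq_iff_eq_add', ← Finset.sum_sub_distrib, Finset.sum_eq_single (x.2.1 u)]
  · simp [pullCount_appendRound]
  · intro k _ hk
    simp [pullCount_appendRound, hk.symm]
  · simp

theorem widthPotential_le_appendRound (x : History U K t × Round U K) :
    widthPotential x.1 ≤ widthPotential (appendRound x) := by
  rw [widthPotential_appendRound]
  exact le_add_of_nonneg_right (Finset.sum_nonneg fun u _ =>
    sub_nonneg.2 (Real.sqrt_le_sqrt (by linarith)))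

theorem two_mul_sqrt_div_le {a n : ℝ} (hn : 1 ≤ n) :
    2 * √(a / n) ≤ 5 * √a * (√(n + 1) - √n) := by
  have hpos : 0 < √n := Real.sqrt_pos.2 (by linarith)
  have hratio : √(n + 1) ≤ 3 / 2 * √n :=
    Real.sqrt_le_iff.2 ⟨by positivity, by rw [mul_pow, Real.sq_sqrt] <;> linarith⟩
  have hle : √n ≤ √(n + 1) := Real.sqrt_le_sqrt (by linarith)
  have hconj : (√(n + 1) - √n) * (√(n + 1) + √n) = 1 := by
    rw [mul_comm, ← sq_sub_sq, Real.sq_sqrt, Real.sq_sqrt] <;> linarith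
  have hinv : 2 / √n ≤ 5 * (√(n + 1) - √n) := by
    rw [div_le_iff₀ hpos]
    nlinarith [mul_nonneg (sub_nonneg.2 hle) (sub_nonneg.2 hratio)]
  calc 2 * √(a / n) = √a * (2 / √n) := by rw [Real.sqrt_div' _ (by linarith)]; ring
    _ ≤ √a * (5 * (√(n + 1) - √n)) := by gcongr
    _ = 5 * √a * (√(n + 1) - √n) := by ring

theorem sum_two_mul_sqrt_div_pullCount_le (a : ℝ) {x : History U K t × Round U K}
    (hpos : ∀ u k, 0 < pullCount x.1 u k) :
    ∑ u, 2 * √(a / pullCount x.1 u (x.2.1 u)) ≤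
      5 * √a * (widthPotential (appendRound x) - widthPotential x.1) := by
  rw [widthPotential_appendRound, add_sub_cancel_left, Finset.mul_sum]
  exact Finset.sum_le_sum fun u _ => two_mul_sqrt_div_le (by exact_mod_cast hpos u _)

end WidthPotential

/-! ### The upper bound -/

section UpperBound

variable {U K t T : ℕ} {b : BudgetConstraint K} {A : Learner U b} (D : RewardModel U K)

theorem integral_historyLaw_succ_le {F : History U K (t + 1) → ℝ} {G : History U K t → ℝ}
    (hF : Integrable F (historyLaw A D (t + 1))) (hG : Integrable G (historyLaw A D t))
    (h : ∀ᵐ x ∂(stepLaw A D t), F (appendRound x) ≤ G x.1) :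
    ∫ h, F h ∂(historyLaw A D (t + 1)) ≤ ∫ h, G h ∂(historyLaw A D t) := by
  rw [historyLaw_succ] at hF ⊢
  rw [← map_fst_stepLaw] at hG ⊢
  rw [integral_map measurable_appendRound.aemeasurable hF.aestronglyMeasurable,
    integral_map measurable_fst.aemeasurable hG.aestronglyMeasurable]
  exact integral_mono_ae (hF.comp_measurable measurable_appendRound)
    (hG.comp_measurable measurable_fst) h

/-- The regret of the matchings played in a history, minus the part of it paid for by the width
potential. -/
noncomputable def unpaidRegret (b : BudgetConstraint K) (T : ℕ) (h : History U K t) : ℝ :=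
  ∑ s, (D.optValue b - D.value (h s).1) - 5 * √(2 * Real.log T) * widthPotential h

theorem integrable_widthPotential :
    Integrable (widthPotential : History U K t → ℝ) (historyLaw A D t) :=
  integrable_comp_matchings A D fun m =>
    ∑ u, ∑ k, √((Finset.univ.filter fun s => m s u = k).card : ℝ)

theorem integrable_sum_optValue_sub_value :
    Integrable (fun h => ∑ s, (D.optValue b - D.value (h s).1)) (historyLaw A D t) :=
  integrable_comp_matchings A D fun m => ∑ s, (D.optValue b - D.value (m s))

theorem integrable_unpaidRegret : Integrable (unpaidRegret D b T) (historyLaw A D t) :=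
  (integrable_sum_optValue_sub_value D).sub ((integrable_widthPotential D).const_mul _)

open Classical in
theorem ae_unpaidRegret_appendRound_le (hA : IsCUCB T A) (hU : U ≤ T) (hK : 1 ≤ K)
    (hKT : K ≤ T) (ht : t < T) :
    ∀ᵐ x ∂(stepLaw A D t), unpaidRegret D b T (appendRound x) ≤ unpaidRegret D b T x.1 +
      ((if WithinConfidence T D x.1 then 0 else (U : ℝ)) +
        if (t : ℝ) ≤ 2 * K * Real.log T then (U : ℝ) else 0) := by
  have htried : ∀ᵐ x ∂(stepLaw A D t),
      2 * K * Real.log T < t → ∀ u k, 0 < pullCount x.1 u k := by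
    refine Filter.eventually_imp_distrib_left.2 fun hlog => ?_
    have := ae_pullCount_pos hA D hU hK hKT ht.le hlog
    exact ae_of_ae_map measurable_fst.aemeasurable (map_fst_stepLaw A D ▸ this)
  filter_upwards [htried, ae_stepLaw_isOptimisticChoice hA D ht] with x hpos hopt
  suffices D.optValue b - D.value x.2.1 ≤
      5 * √(2 * Real.log T) * (widthPotential (appendRound x) - widthPotential x.1) +
      ((if WithinConfidence T D x.1 then 0 else (U : ℝ)) +
        if (t : ℝ) ≤ 2 * K * Real.log T then (U : ℝ) else 0) by
    rw [unpaidRegret, unpaidRegret, sum_appendRound fun y => D.optValue b - D.value y.1]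
    linarith
  have hloss : D.optValue b - D.value x.2.1 ≤ U := by
    linarith [D.optValue_le b, D.value_nonneg x.2.1]
  have hpaid : 0 ≤ 5 * √(2 * Real.log T) *
      (widthPotential (appendRound x) - widthPotential x.1) :=
    mul_nonneg (by positivity) (sub_nonneg.2 (widthPotential_le_appendRound x))
  split_ifs with hconf hexplore hexplore
  · linarith
  · have hpos' := hpos (not_le.1 hexplore)
    have hwidth := optValue_sub_value_le_of_isOptimisticChoice D hopt hpos' hconf
    linarith [sum_two_mul_sqrt_div_pullCount_le (2 * Real.log T) hpos']
  · linarith [(U.cast_nonneg : (0 : ℝ) ≤ U)]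
  · linarith

open Classical in
theorem integrable_ite_withinConfidence :
    Integrable (fun h => if WithinConfidence T D h then 0 else (U : ℝ)) (historyLaw A D t) :=
  .of_bound
    (Measurable.ite (measurableSet_withinConfidence D T) measurable_const
      measurable_const).aestronglyMeasurable U
    (ae_of_all _ fun h => by split_ifs <;> simp)

open Classical in
theorem integral_ite_withinConfidence_le (hU : U ≤ T) (hKT : K ≤ T) (ht : t ≤ T) :
    ∫ h, (if WithinConfidence T D h then 0 else (U : ℝ)) ∂(historyLaw A D t) ≤ U * (2 / T) := by
  have hmiss : (fun h : History U K t => if WithinConfidence T D h then 0 else (U : ℝ)) =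
      {h | WithinConfidence T D h}ᶜ.indicator fun _ => (U : ℝ) := by
    ext h
    by_cases hh : WithinConfidence T D h <;> simp [hh]
  rw [hmiss, integral_indicator_const _ (measurableSet_withinConfidence D T).compl, smul_eq_mul,
    mul_comm]
  gcongr
  exact measureReal_not_withinConfidence_le A D ht hU hKT

theorem integral_unpaidRegret_le (hA : IsCUCB T A) (hU : U ≤ T) (hK : 1 ≤ K) (hKT : K ≤ T)
    (ht : t ≤ T) :
    ∫ h, unpaidRegret D b T h ∂(historyLaw A D t) ≤
      ∑ s ∈ Finset.range t,
        (U * (2 / T) + if (s : ℝ) ≤ 2 * K * Real.log T then (U : ℝ) else 0) := by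
  classical
  induction t with
  | zero => simp [unpaidRegret, widthPotential, pullCount]
  | succ t ih =>
    have hmiss_int := integrable_ite_withinConfidence (A := A) (t := t) (T := T) D
    have hstep := integral_historyLaw_succ_le D (integrable_unpaidRegret D)
      ((integrable_unpaidRegret D).add (hmiss_int.add (integrable_const _)))
      (ae_unpaidRegret_appendRound_le D hA hU hK hKT ht)
    rw [integral_add' (integrable_unpaidRegret D) (hmiss_int.add (integrable_const _)),
      integral_add' hmiss_int (integrable_const _), integral_const, probReal_univ,
      one_smul] at hstep
    rw [Finset.sum_range_succ]
    linarith [ih (by omega), integral_ite_withinConfidence_le (A := A) (t := t) D hU hKT (by omega)]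

theorem sum_range_ite_le {a c : ℝ} (ha : 0 ≤ a) (hc : 0 ≤ c) (n : ℕ) :
    ∑ s ∈ Finset.range n, (if (s : ℝ) ≤ a then c else 0) ≤ (a + 1) * c := by
  have hsub : (Finset.range n).filter (fun s : ℕ => (s : ℝ) ≤ a) ⊆ Finset.range (⌊a⌋₊ + 1) :=
    fun s hs => Finset.mem_range_succ_iff.2 (Nat.le_floor (Finset.mem_filter.1 hs).2)
  have hcard : (((Finset.range n).filter fun s : ℕ => (s : ℝ) ≤ a).card : ℝ) ≤ ⌊a⌋₊ + 1 := by
    exact_mod_cast (Finset.card_le_card hsub).trans_eq (Finset.card_range _)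
  rw [← Finset.sum_filter, Finset.sum_const, nsmul_eq_mul]
  exact mul_le_mul_of_nonneg_right (by linarith [Nat.floor_le ha]) hc

theorem regret_le_of_isCUCB (hA : IsCUCB T A) (hU : U ≤ T) (hK : 1 ≤ K) (hKT : K ≤ T) :
    regret T A D ≤ U * (2 * K * Real.log T + 3) + 5 * √(2 * Real.log T) * (U * √(K * T)) := by
  have hT : (T : ℝ) ≠ 0 := Nat.cast_ne_zero.2 (by omega)
  have hunpaid : ∫ h, unpaidRegret D b T h ∂(historyLaw A D T) ≤
      U * (2 * K * Real.log T + 3) := by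
    refine (integral_unpaidRegret_le D hA hU hK hKT le_rfl).trans ?_
    have hexplore := sum_range_ite_le (a := 2 * K * Real.log T) (by positivity) U.cast_nonneg T
    rw [Finset.sum_add_distrib, Finset.sum_const, Finset.card_range, nsmul_eq_mul,
      mul_left_comm, mul_div_cancel₀ _ hT]
    linarith
  have hpaid : ∫ h : History U K T, 5 * √(2 * Real.log T) * widthPotential h
      ∂(historyLaw A D T) ≤ 5 * √(2 * Real.log T) * (U * √(K * T)) := by
    refine (integral_mono ((integrable_widthPotential D).const_mul _)
      (integrable_const (5 * √(2 * Real.log T) * (U * √(K * T)))) fun h => ?_).trans_eq (by simp)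
    exact mul_le_mul_of_nonneg_left (widthPotential_le h) (by positivity)
  have hsplit : regret T A D = ∫ h, unpaidRegret D b T h ∂(historyLaw A D T) +
      ∫ h : History U K T, 5 * √(2 * Real.log T) * widthPotential h ∂(historyLaw A D T) := by
    rw [regret_eq_integral_sum, ← integral_add (integrable_unpaidRegret D)
      ((integrable_widthPotential D).const_mul _)]
    simp only [unpaidRegret, sub_add_cancel]
  linarith

theorem regret_le_zero_of_single_arm {b : BudgetConstraint 1} (A : Learner U b)
    (D : RewardModel U 1) (T : ℕ) : regret T A D ≤ 0 := by
  rw [regret_eq_integral_sum]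
  refine integral_nonpos fun h => Finset.sum_nonpos fun t _ => sub_nonpos.2 ?_
  have : Nonempty {π : Matching U 1 // b.Feasible π} := ⟨⟨_, b.feasible_const 0⟩⟩
  exact ciSup_le fun π => le_of_eq (by rw [Subsingleton.elim π.1])

theorem regret_le_sqrt_of_isCUCB (hA : IsCUCB T A) (hU : U ≤ T) (hK : 1 ≤ K) (hKT : K ≤ T) :
    regret T A D ≤ 13 * (U * √(K * T * Real.log T)) := by
  rcases Nat.lt_or_ge T 2 with hT | hT
  · obtain rfl : K = 1 := by omega
    exact (regret_le_zero_of_single_arm A D T).trans (by positivity)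
  have hT' : (2 : ℝ) ≤ T := by exact_mod_cast hT
  have hK' : (1 : ℝ) ≤ K := by exact_mod_cast hK
  have hlog : 1 / 2 ≤ Real.log T := by
    linarith [Real.log_two_gt_d9, Real.log_le_log (by norm_num) hT']
  have hlog0 : 0 ≤ Real.log T := by linarith
  rcases le_total (T : ℝ) (K * Real.log T) with h | h
  · have hT_le : (T : ℝ) ≤ √(K * T * Real.log T) :=
      Real.le_sqrt_of_sq_le (by nlinarith)
    calc regret T A D ≤ T * U := regret_le_mul_users A D T
      _ ≤ √(K * T * Real.log T) * U := by gcongr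
      _ ≤ 13 * (U * √(K * T * Real.log T)) := by
        nlinarith [mul_nonneg (U.cast_nonneg : (0 : ℝ) ≤ U) (Real.sqrt_nonneg (K * T * Real.log T))]
  · have hexplore : K * Real.log T ≤ √(K * T * Real.log T) :=
      Real.le_sqrt_of_sq_le (by nlinarith [mul_nonneg (K.cast_nonneg : (0 : ℝ) ≤ K) hlog0])
    have hone : 1 ≤ √(K * T * Real.log T) :=
      Real.one_le_sqrt.2 (by nlinarith [mul_le_mul hK' hT' (by norm_num) (by linarith)])
    have hwidth : √(2 * Real.log T) * √(K * T) ≤ 8 / 5 * √(K * T * Real.log T) := by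
      rw [← Real.sqrt_mul (by positivity),
        show 2 * Real.log T * (K * T) = 2 * (K * T * Real.log T) by ring,
        Real.sqrt_mul (by norm_num)]
      gcongr
      exact Real.sqrt_le_iff.2 (by norm_num)
    calc regret T A D
        ≤ U * (2 * (K * Real.log T) + 3 * 1 + 5 * (√(2 * Real.log T) * √(K * T))) :=
          (regret_le_of_isCUCB D hA hU hK hKT).trans_eq (by ring)
      _ ≤ U * (2 * √(K * T * Real.log T) + 3 * √(K * T * Real.log T) +
          5 * (8 / 5 * √(K * T * Real.log T))) := by gcongr
      _ = 13 * (U * √(K * T * Real.log T)) := by ring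

end UpperBound

theorem mainTheorem11_general :
    (∃ C : ℝ, 0 < C ∧ ∀ U K T : ℕ, 1 ≤ K → U ≤ T → K ≤ T → ∀ b : BudgetConstraint K,
      (∃ A : Learner U b, IsCUCB T A) ∧
      ∀ A : Learner U b, IsCUCB T A → ∀ D : RewardModel U K,
        regret T A D ≤ C * (U * √(K * T * Real.log T))) ∧
    (∃ c : ℝ, 0 < c ∧ ∀ U K T : ℕ, 2 ≤ K → K ≤ T → ∃ b : BudgetConstraint K,
      ∀ A : Learner U b, ∃ D : RewardModel U K, c * (U * √(K * T)) ≤ regret T A D) :=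
  ⟨⟨13, by norm_num, fun _ _ T hK hU hKT b => ⟨exists_isCUCB b hK T,
      fun _ hA D => regret_le_sqrt_of_isCUCB D hA hU hK hKT⟩⟩,
    ⟨1 / 96, by norm_num, fun _ K _ hK hKT => ⟨freeConstraint K,
      exists_le_regret_freeConstraint hK hKT⟩⟩⟩

theorem mainTheorem11 :
    (∃ C : ℝ, 0 < C ∧ ∀ U K T : ℕ, 1 ≤ U → 1 ≤ K → U ≤ T → K ≤ T → ∀ b : BudgetConstraint K,
      (∃ A : Learner U b, IsCUCB T A) ∧
      ∀ A : Learner U b, IsCUCB T A → ∀ D : RewardModel U K,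
        regret T A D ≤ C * (U * Real.sqrt (K * T * Real.log T))) ∧
    (∃ c : ℝ, 0 < c ∧ ∀ U K T : ℕ, 1 ≤ U → 2 ≤ K → U ≤ T → K ≤ T → ∃ b : BudgetConstraint K,
      ∀ A : Learner U b, ∃ D : RewardModel U K,
        c * (U * Real.sqrt (K * T)) ≤ regret T A D) := by
  obtain ⟨⟨C, hC, hupper⟩, c, hc, hlower⟩ := mainTheorem11_general
  exact ⟨⟨C, hC, fun U K T _ => hupper U K T⟩, c, hc, fun U K T _ hK _ => hlower U K T hK⟩
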